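/- Let $0<L<2\pi$ and $\mathbb T^2=\mathbb R^2/(L\mathbb Z)^2$. For $k\in\mathbb Z^2$ write $|k|=\max\{|k_1|,|k_2|\}$, $\lambda_k=(2\pi/L)^2(k_1^2+k_2^2)-1$ and $e_k(x)=L^{-1}e^{i(2\pi/L)k\cdot x}$. For $N\in\mathbb N$ let $\gamma_0^\perp=\gamma_{0,N}^\perp$ be the Gaussian probability measure, with density proportional to $\exp\bigl(-\tfrac12\sum_{0<|k|\le N}\lambda_k|y_k|^2\bigr)$, on the real Euclidean space of families $y_\perp=(y_k)_{0<|k|\le N}$ of complex numbers with $y_{-k}=\overline{y_k}$ and norm $\bigl(\sum_k|y_k|^2\bigr)^{1/2}$. Set $$\hat\phi_{N,\perp}(x)=\sum_{0<|k|\le N}y_ke_k(x),\qquad C_N^\perp=\frac1{L^2}\sum_{0<|k|\le N}\frac1{\lambda_k},\qquad U_{n,N}^\perp=\int_{\mathbb T^2}H_n\bigl(\hat\phi_{N,\perp}(x),C_N^\perp\bigr)\,dx,$$ where $H_0(X,C)=1$ and $H_n=XH_{n-1}-C\,\partial_XH_{n-1}$ for $n\ge1$. For $\varepsilon>0$ and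 $z_0\in\mathbb R$ let $$w_{N,\perp}(z_0,y_\perp)=\frac{3(z_0^2-\varepsilon)}{2L^2}U_{2,N}^\perp+\frac{z_0}{L}\sqrt{\varepsilon}\,U_{3,N}^\perp+\frac{\varepsilon}{4}U_{4,N}^\perp,\qquad K(z_0)=\Bigl[\prod_{0<|k|\le N}\frac{e^{3z_0^2/(L^2\lambda_k)}}{1+3z_0^2/(L^2\lambda_k)}\Bigr]^{1/2}.$$ Then there are constants $M>0$ and $\varepsilon_0>0$, depending only on $L$, such that for all $N\in\mathbb N$, all $\varepsilon\in(0,\varepsilon_0)$ and all $z_0\in\mathbb R$ the random variable $e^{-w_{N,\perp}(z_0,\cdot)}$ is $\gamma_0^\perp$-integrable and $$\mathbb E^{\gamma_0^\perp}\bigl[e^{-w_{N,\perp}(z_0,\cdot)}\bigr]\le K(z_0)\Bigl[1+M\sqrt\varepsilon\,(1+|z_0|)\bigl(1+\sqrt\varepsilon\,e^{Mz_0^2\log(1+z_0^2)/\sqrt\varepsilon}\bigr)\Bigr].$$ -/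

import Mathlib

noncomputable section

namespace AllenCahn

/-- The transversal wave vectors `0 < |k| ≤ N`, where `|k| = max (|k₁|, |k₂|)`. -/
def modes (N : ℕ) : Finset (ℤ × ℤ) :=
  (Finset.Icc (-(N : ℤ)) N ×ˢ Finset.Icc (-(N : ℤ)) N).filter (fun k => k ≠ 0)

theorem neg_mem_modes {N : ℕ} {k : ℤ × ℤ} (hk : k ∈ modes N) : -k ∈ modes N := by
  simp only [modes, Finset.mem_filter, Finset.mem_product, Finset.mem_Icc, Prod.fst_neg,
    Prod.snd_neg, ne_eq, neg_eq_zero] at hk ⊢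
  obtain ⟨⟨⟨h1, h2⟩, h3, h4⟩, h5⟩ := hk
  exact ⟨⟨⟨by omega, by omega⟩, by omega, by omega⟩, h5⟩

/-- The eigenvalue `λ_k = (2π/L)² (k₁² + k₂²) - 1` of `-Δ - 1` on the torus of side `L`. -/
def eigenvalue (L : ℝ) (k : ℤ × ℤ) : ℝ :=
  (2 * Real.pi / L) ^ 2 * ((k.1 : ℝ) ^ 2 + (k.2 : ℝ) ^ 2) - 1

/-- The Fourier basis function `e_k(x) = L⁻¹ exp (i (2π/L) k·x)`. -/
def fourierMode (L : ℝ) (k : ℤ × ℤ) (x : ℝ × ℝ) : ℂ :=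
  (L : ℂ)⁻¹ * Complex.exp
    (Complex.I * ((2 * Real.pi / L * ((k.1 : ℝ) * x.1 + (k.2 : ℝ) * x.2) : ℝ) : ℂ))

/-- A choice of one wave vector in each pair `{k, -k}`, `k ≠ 0`. -/
def IsUpper (k : ℤ × ℤ) : Prop := 0 < k.1 ∨ (k.1 = 0 ∧ 0 < k.2)

open Classical in
/-- The complex Fourier coefficients `y_k` encoded by real coordinates `u`. The map
`u ↦ (y_k)` is the linear identification of `ℝ^{(2N+1)² - 1}` with the space of families that
satisfy `y_{-k} = conj y_k`; it is isometric, `∑ |y_k|² = ∑ u_k²`. -/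
def coeff {N : ℕ} (u : modes N → ℝ) (k : modes N) : ℂ :=
  if IsUpper k.1 then
    ((u k : ℂ) + Complex.I * (u ⟨-k.1, neg_mem_modes k.2⟩ : ℂ)) / (Real.sqrt 2 : ℂ)
  else
    ((u ⟨-k.1, neg_mem_modes k.2⟩ : ℂ) - Complex.I * (u k : ℂ)) / (Real.sqrt 2 : ℂ)

/-- The fluctuating field `∑_{0<|k|≤N} y_k e_k(x)`. The sum is real because
`y_{-k} = conj y_k`; the real part only casts it to `ℝ`. -/
def field (L : ℝ) {N : ℕ} (u : modes N → ℝ) (x : ℝ × ℝ) : ℝ :=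
  (∑ k : modes N, coeff u k * fourierMode L k.1 x).re

/-- The quadratic form `½ ∑_{0<|k|≤N} λ_k |y_k|²`. -/
def quadForm (L : ℝ) {N : ℕ} (u : modes N → ℝ) : ℝ :=
  1 / 2 * ∑ k : modes N, eigenvalue L k.1 * ‖coeff u k‖ ^ 2

/-- The normalisation `∏_{0<|k|≤N} √(2π/λ_k)`. -/
def normalisation (L : ℝ) (N : ℕ) : ℝ :=
  ∏ k : modes N, Real.sqrt (2 * Real.pi / eigenvalue L k.1)

/-- The Gaussian measure with Lebesgue density `exp (-quadForm) / normalisation`. -/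
def gaussianPerp (L : ℝ) (N : ℕ) : MeasureTheory.Measure (modes N → ℝ) :=
  (MeasureTheory.volume : MeasureTheory.Measure (modes N → ℝ)).withDensity
    (fun u => ENNReal.ofReal (Real.exp (-quadForm L u) / normalisation L N))

/-- The renormalisation constant `L⁻² ∑_{0<|k|≤N} 1/λ_k`. -/
def renormConst (L : ℝ) (N : ℕ) : ℝ :=
  1 / L ^ 2 * ∑ k : modes N, 1 / eigenvalue L k.1

/-- Hermite polynomials with variance `c`: `H₀ = 1`, `H_{n+1} = X H_n - c H_n'`. -/
def hermitePoly (c : ℝ) : ℕ → Polynomial ℝ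
  | 0 => 1
  | n + 1 => Polynomial.X * hermitePoly c n
      - Polynomial.C c * Polynomial.derivative (hermitePoly c n)

/-- The integrated Wick power `∫_{𝕋²} H_n(φ(x), C) dx`, the torus being represented by the
fundamental cell `(0, L]²`. -/
def wickIntegral (L : ℝ) {N : ℕ} (n : ℕ) (u : modes N → ℝ) : ℝ :=
  ∫ x in Set.Ioc (0 : ℝ) L ×ˢ Set.Ioc (0 : ℝ) L,
    (hermitePoly (renormConst L N) n).eval (field L u x)

/-- The transversal interaction
`w(z₀, y) = 3(z₀² - ε)/(2L²) U₂ + (z₀/L) √ε U₃ + (ε/4) U₄`. -/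
def interaction (L ε z₀ : ℝ) {N : ℕ} (u : modes N → ℝ) : ℝ :=
  3 * (z₀ ^ 2 - ε) / (2 * L ^ 2) * wickIntegral L 2 u
    + z₀ / L * Real.sqrt ε * wickIntegral L 3 u
    + 1 / 4 * ε * wickIntegral L 4 u

/-- The determinant factor `K(z₀) = [∏_{0<|k|≤N} exp (ζ_k) / (1 + ζ_k)]^{1/2}` with
`ζ_k = 3 z₀² / (L² λ_k)`. -/
def detFactor (L : ℝ) (N : ℕ) (z₀ : ℝ) : ℝ :=
  Real.sqrt (∏ k : modes N,
    Real.exp (3 * z₀ ^ 2 / (L ^ 2 * eigenvalue L k.1))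
      / (1 + 3 * z₀ ^ 2 / (L ^ 2 * eigenvalue L k.1)))

end AllenCahn

end

/-!
The interaction `w` is the renormalised quartic potential of the fluctuating field; everything is
uniform in the cutoff `N` because of Nelson's argument, which combines two facts.

* *Lower bound* (`exists_interaction_ge`). Written out, the integrand of `w` is a quartic polynomial
  in the field whose quadratic, cubic and quartic coefficients form a positive definite
  combination (`quartic_ge`). What remains is `w ≥ -c (R (j+1) + (j+1)²)` for `z₀² ≤ R` and a cutoff
  at most `2 ^ j`, since the renormalisation constant diverges logarithmically.
* *Small fluctuations beyond a cutoff* (`exists_integral_interaction_sub_pow_le`). The difference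
  of the interactions with cutoffs `N` and `M ≤ N` has moments of order `2m` at most
  `(A R² m⁴ (M+1)^(-1/8))^m`.

Hence `w < -2 b_j`, with `b_j` the lower bound at scale `j`, forces a fluctuation of size `b_j`
beyond the cutoff `2 ^ j`; a moment of order comparable to `b_{j+1}` shows that this has probability
at most `exp (-4 b_{j+1} - j)` once `j` exceeds a multiple of `log R`, and summation over `j` gives
`E[exp (-2 w)] ≤ exp (C R log (1+R))` (`exists_integral_exp_interaction_le`).

The moment bound needs no general hypercontractivity. The integrated Wick powers, and their
differences at two cutoffs, are polynomials `F` with `L F = -n F` for the Ornstein-Uhlenbeck operator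
`L`, and their partial derivatives are of the same form with `n - 1` in place of `n`. Integration by
parts gives `n E[F^(2m)] = (2m-1) ∑ s_i E[F^(2m-2) (∂_i F)²]`, and Young's inequality and induction
on `n` bound the moments by the square norm of the kernel
(`IsSteinMeasure.integral_wickPoly_pow_le`). The difference at two cutoffs is treated as one such
polynomial by working over a product of two function algebras. The kernel norm is a sum over wave
vectors with a vanishing signed sum, not all below the cutoff, which is estimated by a discrete
Young inequality (`exists_lattice_sum_le`).

The quadratic part `Q` of `w`, its value at `ε = 0`, has `E[exp (-Q)] = K(z₀)` by Parseval and a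
product of one-dimensional Gaussian integrals. For `|z₀| ≤ 1` the rest `X = w - Q` has second moment
`O(ε)`, and `exp (-w) ≤ exp (-Q) + |X| (exp (-Q) + exp (-w))` together with Nelson's estimate for `w`
and `Q` gives `K(z₀) + O(√ε)`, while `K(z₀) ≥ 1`. For `|z₀| ≥ 1` Nelson's estimate with `R = z₀²` is
itself below the exponential term of the bound.
-/

noncomputable section

namespace AllenCahn

open MeasureTheory

/-! ### Real coordinates on the Gaussian space -/

theorem eigenvalue_neg (L : ℝ) (k : ℤ × ℤ) : eigenvalue L (-k) = eigenvalue L k := by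
  simp [eigenvalue]

theorem eigenvalue_ge (L : ℝ) {k : ℤ × ℤ} (hk : k ≠ 0) :
    ((2 * Real.pi / L) ^ 2 - 1) * ((k.1 : ℝ) ^ 2 + (k.2 : ℝ) ^ 2) ≤ eigenvalue L k := by
  have h1 : (1 : ℝ) ≤ (k.1 : ℝ) ^ 2 + (k.2 : ℝ) ^ 2 := by
    have : (1 : ℤ) ≤ k.1 ^ 2 + k.2 ^ 2 := by
      by_contra h
      have h0 : k.1 ^ 2 + k.2 ^ 2 = 0 := by nlinarith [sq_nonneg k.1, sq_nonneg k.2]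
      have h1 : k.1 = 0 := by nlinarith [sq_nonneg k.1, sq_nonneg k.2]
      have h2 : k.2 = 0 := by nlinarith [sq_nonneg k.1, sq_nonneg k.2]
      exact hk (Prod.ext h1 h2)
    exact_mod_cast this
  rw [eigenvalue]
  nlinarith

theorem one_lt_frequency_sq {L : ℝ} (hL : 0 < L) (hL' : L < 2 * Real.pi) :
    1 < (2 * Real.pi / L) ^ 2 := by
  have : 1 < 2 * Real.pi / L := by rwa [lt_div_iff₀ hL, one_mul]
  nlinarith

theorem eigenvalue_pos {L : ℝ} (hL : 0 < L) (hL' : L < 2 * Real.pi) {k : ℤ × ℤ} (hk : k ≠ 0) :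
    0 < eigenvalue L k := by
  refine lt_of_lt_of_le (mul_pos (sub_pos.2 (one_lt_frequency_sq hL hL')) ?_)
    (eigenvalue_ge L hk)
  rcases eq_or_ne k.1 0 with h | h
  · have h2 : k.2 ≠ 0 := fun h2 => hk (Prod.ext h h2)
    have : (k.2 : ℝ) ≠ 0 := by exact_mod_cast h2
    positivity
  · have : (k.1 : ℝ) ≠ 0 := by exact_mod_cast h
    positivity

theorem ne_zero_of_mem_modes {N : ℕ} {k : ℤ × ℤ} (hk : k ∈ modes N) : k ≠ 0 := by
  simp only [modes, Finset.mem_filter] at hk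
  exact hk.2

/-- The involution `k ↦ -k` of the wave vectors. -/
def negMode (N : ℕ) : modes N ≃ modes N where
  toFun k := ⟨-k.1, neg_mem_modes k.2⟩
  invFun k := ⟨-k.1, neg_mem_modes k.2⟩
  left_inv k := by simp
  right_inv k := by simp

theorem sum_symmetrize {N : ℕ} (f : modes N → ℝ) :
    ∑ k, (f k + f (negMode N k)) / 2 = ∑ k, f k := by
  rw [← Finset.sum_div, Finset.sum_add_distrib, (negMode N).sum_comp f]
  ring

theorem isUpper_neg_iff {k : ℤ × ℤ} (hk : k ≠ 0) : IsUpper (-k) ↔ ¬ IsUpper k := by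
  have : k.1 ≠ 0 ∨ k.2 ≠ 0 := by
    by_contra! h
    exact hk (Prod.ext h.1 h.2)
  simp only [IsUpper, Prod.fst_neg, Prod.snd_neg]
  omega

/-- The phase `(2π/L) k·x`. -/
def phase (L : ℝ) (k : ℤ × ℤ) (x : ℝ × ℝ) : ℝ :=
  2 * Real.pi / L * ((k.1 : ℝ) * x.1 + (k.2 : ℝ) * x.2)

theorem phase_neg (L : ℝ) (k : ℤ × ℤ) (x : ℝ × ℝ) : phase L (-k) x = -phase L k x := by
  simp [phase]; ring

open Classical in
/-- The real orthonormal basis dual to the coordinates of `coeff`: a cosine for an upper wave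
vector, a sine for the opposite one. -/
def realMode (L : ℝ) (k : ℤ × ℤ) (x : ℝ × ℝ) : ℝ :=
  if IsUpper k then Real.sqrt 2 / L * Real.cos (phase L k x)
  else Real.sqrt 2 / L * Real.sin (phase L k x)

theorem field_eq (L : ℝ) {N : ℕ} (u : modes N → ℝ) (x : ℝ × ℝ) :
    field L u x = ∑ k, u k * realMode L k.1 x := by
  rw [field, Complex.re_sum, ← sum_symmetrize (fun k => u k * realMode L k.1 x)]
  refine Finset.sum_congr rfl fun k _ => ?_
  have hk := isUpper_neg_iff (ne_zero_of_mem_modes k.2)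
  have h2 : Real.sqrt 2 ≠ 0 := by positivity
  have hs : Real.sqrt 2 * Real.sqrt 2 = 2 := Real.mul_self_sqrt (by norm_num)
  have hi : (Real.sqrt 2)⁻¹ = Real.sqrt 2 / 2 := by field_simp; linarith
  have hexp : fourierMode L k.1 x = ((L⁻¹ * Real.cos (phase L k.1 x) : ℝ) : ℂ)
      + ((L⁻¹ * Real.sin (phase L k.1 x) : ℝ) : ℂ) * Complex.I := by
    rw [fourierMode, mul_comm Complex.I, Complex.exp_mul_I, ← Complex.ofReal_cos,
      ← Complex.ofReal_sin]
    simp only [phase]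
    push_cast
    ring
  by_cases hu : IsUpper k.1
  · have hn : ¬ IsUpper (-k.1) := by rw [hk]; exact not_not.2 hu
    simp only [coeff, hu, if_true, realMode, negMode, Equiv.coe_fn_mk, hn, if_false, hexp,
      phase_neg, Real.sin_neg]
    rw [div_eq_mul_inv, ← Complex.ofReal_inv, hi]
    simp [Complex.mul_re, Complex.mul_im, -Complex.ofReal_cos, -Complex.ofReal_sin]
    ring
  · have hn : IsUpper (-k.1) := hk.2 hu
    simp only [coeff, hu, if_true, realMode, negMode, Equiv.coe_fn_mk, hn, if_false, hexp,
      phase_neg, Real.cos_neg]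
    rw [div_eq_mul_inv, ← Complex.ofReal_inv, hi]
    simp [Complex.mul_re, Complex.mul_im, -Complex.ofReal_cos, -Complex.ofReal_sin]
    ring

theorem norm_coeff_sq {N : ℕ} (u : modes N → ℝ) (k : modes N) :
    ‖coeff u k‖ ^ 2 = (u k ^ 2 + u (negMode N k) ^ 2) / 2 := by
  have hs : Real.sqrt 2 ^ 2 = 2 := Real.sq_sqrt (by norm_num)
  rw [coeff]
  split_ifs
  · rw [norm_div, div_pow, Complex.norm_real, Real.norm_eq_abs, sq_abs, hs, Complex.sq_norm,
      Complex.normSq_apply]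
    simp [negMode]
    ring
  · rw [norm_div, div_pow, Complex.norm_real, Real.norm_eq_abs, sq_abs, hs, Complex.sq_norm,
      Complex.normSq_apply]
    simp [negMode]
    ring

theorem quadForm_eq (L : ℝ) {N : ℕ} (u : modes N → ℝ) :
    quadForm L u = ∑ k : modes N, eigenvalue L k.1 / 2 * u k ^ 2 := by
  rw [quadForm, ← sum_symmetrize (fun k : modes N => eigenvalue L k.1 / 2 * u k ^ 2), Finset.mul_sum]
  refine Finset.sum_congr rfl fun k _ => ?_
  have : eigenvalue L (negMode N k).1 = eigenvalue L k.1 := eigenvalue_neg L k.1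
  rw [norm_coeff_sq, this]
  ring

theorem renormConst_eq {L : ℝ} (N : ℕ) (x : ℝ × ℝ) :
    renormConst L N = ∑ k : modes N, 1 / eigenvalue L k.1 * realMode L k.1 x ^ 2 := by
  rw [renormConst, ← sum_symmetrize (fun k : modes N => 1 / eigenvalue L k.1 * realMode L k.1 x ^ 2),
    Finset.mul_sum]
  refine Finset.sum_congr rfl fun k _ => ?_
  have h : eigenvalue L (negMode N k).1 = eigenvalue L k.1 := eigenvalue_neg L k.1
  have h' : realMode L k.1 x ^ 2 + realMode L (negMode N k).1 x ^ 2 = 2 / L ^ 2 := by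
    have hk := isUpper_neg_iff (ne_zero_of_mem_modes k.2)
    have hs : Real.sqrt 2 ^ 2 = 2 := Real.sq_sqrt (by norm_num)
    by_cases hu : IsUpper k.1
    · have hn : ¬ IsUpper (-k.1) := by rw [hk]; exact not_not.2 hu
      simp only [realMode, negMode, Equiv.coe_fn_mk, hn, hu, if_true, if_false, phase_neg,
        Real.sin_neg, mul_pow, div_pow, hs, neg_sq, ← mul_add, Real.cos_sq_add_sin_sq, mul_one]
    · have hn : IsUpper (-k.1) := hk.2 hu
      simp only [realMode, negMode, Equiv.coe_fn_mk, hn, hu, if_true, if_false, phase_neg,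
        Real.cos_neg, mul_pow, div_pow, hs, ← mul_add, Real.sin_sq_add_cos_sq, mul_one]
  rw [h]
  linear_combination (-1 / 2 * (1 / eigenvalue L k.1)) * h'

/-! ### The Gaussian measure as a product -/

/-- The density of the centred Gaussian of variance `1/l`. -/
def gaussDensity (l x : ℝ) : ℝ := Real.exp (-(l / 2) * x ^ 2) / Real.sqrt (2 * Real.pi / l)

theorem integrable_gaussDensity_mul_pow {l : ℝ} (hl : 0 < l) (d : ℕ) :
    Integrable (fun x : ℝ => x ^ d * gaussDensity l x) := by
  have h := integrable_rpow_mul_exp_neg_mul_sq (half_pos hl)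
    (s := d) (lt_of_lt_of_le (by norm_num) d.cast_nonneg)
  simp only [Real.rpow_natCast] at h
  simpa only [gaussDensity, mul_div_assoc] using h.div_const (Real.sqrt (2 * Real.pi / l))

theorem integral_gaussDensity {l : ℝ} (hl : 0 < l) : ∫ x, gaussDensity l x = 1 := by
  simp only [gaussDensity]
  rw [integral_div, integral_gaussian]
  have : Real.pi / (l / 2) = 2 * Real.pi / l := by field_simp
  rw [this]
  exact div_self (by positivity)

theorem hasDerivAt_gaussDensity (l x : ℝ) :
    HasDerivAt (gaussDensity l) (-l * (x * gaussDensity l x)) x := by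
  have h : HasDerivAt (fun y : ℝ => -(l / 2) * y ^ 2) (-(l / 2) * (2 * x)) x := by
    simpa using (hasDerivAt_pow 2 x).const_mul (-(l / 2))
  refine (h.exp.div_const _).congr_deriv ?_
  rw [gaussDensity]
  ring

/-- Gaussian moment recursion, by integration by parts. -/
theorem integral_pow_succ_gaussDensity {l : ℝ} (hl : 0 < l) (d : ℕ) :
    ∫ x, x ^ (d + 1) * gaussDensity l x
      = 1 / l * (d * ∫ x, x ^ (d - 1) * gaussDensity l x) := by
  have hi := integrable_gaussDensity_mul_pow hl
  have h := integral_mul_deriv_eq_deriv_mul_of_integrable (u := fun x : ℝ => x ^ d)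
    (v := gaussDensity l) (u' := fun x => d * x ^ (d - 1))
    (v' := fun x => -l * (x * gaussDensity l x)) (fun x _ => hasDerivAt_pow d x)
    (fun x _ => hasDerivAt_gaussDensity l x)
    (by
      refine ((hi (d + 1)).const_mul (-l)).congr (.of_forall fun x => ?_)
      simp only [Pi.mul_apply]; ring)
    (by
      refine ((hi (d - 1)).const_mul d).congr (.of_forall fun x => ?_)
      simp only [Pi.mul_apply]; ring)
    (hi d)
  have h1 : ∫ x, x ^ d * (-l * (x * gaussDensity l x))
      = -l * ∫ x, x ^ (d + 1) * gaussDensity l x := by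
    rw [← integral_const_mul]
    congr 1; ext x; ring
  have h2 : ∫ x, (d : ℝ) * x ^ (d - 1) * gaussDensity l x
      = d * ∫ x, x ^ (d - 1) * gaussDensity l x := by
    rw [← integral_const_mul]
    congr 1; ext x; ring
  rw [h1, h2] at h
  field_simp
  linarith

section Product

variable {L : ℝ} {N : ℕ}

theorem gaussianPerp_density (u : modes N → ℝ) :
    Real.exp (-quadForm L u) / normalisation L N
      = ∏ k : modes N, gaussDensity (eigenvalue L k.1) (u k) := by
  simp only [gaussDensity, Finset.prod_div_distrib, normalisation, quadForm_eq,
    ← Finset.sum_neg_distrib, Real.exp_sum, neg_mul]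

theorem continuous_gaussDensity (l : ℝ) : Continuous (gaussDensity l) := by
  unfold gaussDensity
  fun_prop

theorem gaussDensity_nonneg (l x : ℝ) : 0 ≤ gaussDensity l x := by
  unfold gaussDensity
  positivity

theorem gaussianPerp_eq (L : ℝ) (N : ℕ) : gaussianPerp L N =
    (volume : Measure (modes N → ℝ)).withDensity
      (fun u => ENNReal.ofReal (∏ k : modes N, gaussDensity (eigenvalue L k.1) (u k))) := by
  simp only [gaussianPerp, gaussianPerp_density]

theorem measurable_prod_gaussDensity : Measurable (fun u : modes N → ℝ =>
    ENNReal.ofReal (∏ k : modes N, gaussDensity (eigenvalue L k.1) (u k))) := by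
  have : Continuous (fun u : modes N → ℝ =>
      ∏ k : modes N, gaussDensity (eigenvalue L k.1) (u k)) :=
    continuous_finsetProd _ fun k _ => (continuous_gaussDensity _).comp (continuous_apply k)
  exact this.measurable.ennreal_ofReal

theorem integral_gaussianPerp_prod (f : modes N → ℝ → ℝ) :
    ∫ u, ∏ k, f k (u k) ∂(gaussianPerp L N)
      = ∏ k, ∫ x, f k x * gaussDensity (eigenvalue L k.1) x := by
  rw [gaussianPerp_eq, integral_withDensity_eq_integral_toReal_smul measurable_prod_gaussDensity
    (.of_forall fun _ => ENNReal.ofReal_lt_top),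
    ← integral_fintype_prod_volume_eq_prod (fun k x => f k x * gaussDensity (eigenvalue L k.1) x)]
  congr 1
  ext u
  rw [ENNReal.toReal_ofReal (Finset.prod_nonneg fun k _ => gaussDensity_nonneg _ _), smul_eq_mul,
    Finset.prod_mul_distrib, mul_comm]

theorem integrable_gaussianPerp_prod {f : modes N → ℝ → ℝ}
    (hf : ∀ k, Integrable (fun x => f k x * gaussDensity (eigenvalue L k.1) x)) :
    Integrable (fun u : modes N → ℝ => ∏ k, f k (u k)) (gaussianPerp L N) := by
  rw [gaussianPerp_eq, integrable_withDensity_iff_integrable_smul' measurable_prod_gaussDensity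
    (.of_forall fun _ => ENNReal.ofReal_lt_top)]
  refine (Integrable.fintype_prod (f := fun k x => f k x * gaussDensity (eigenvalue L k.1) x)
    hf).congr (.of_forall fun u => ?_)
  simp only
  rw [ENNReal.toReal_ofReal (Finset.prod_nonneg fun k _ => gaussDensity_nonneg _ _), smul_eq_mul,
    Finset.prod_mul_distrib, mul_comm]

theorem isProbabilityMeasure_gaussianPerp (hL : 0 < L) (hL' : L < 2 * Real.pi) (N : ℕ) :
    IsProbabilityMeasure (gaussianPerp L N) := by
  have hl := fun k : modes N => eigenvalue_pos hL hL' (ne_zero_of_mem_modes k.2)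
  have hint := integrable_gaussianPerp_prod (L := L) (N := N) (f := fun _ _ => 1)
    (fun k => by simpa using integrable_gaussDensity_mul_pow (hl k) 0)
  have h := integral_gaussianPerp_prod (L := L) (N := N) (f := fun _ _ => 1)
  have hfin : IsFiniteMeasure (gaussianPerp L N) := by
    have : Integrable (fun _ : modes N → ℝ => (1 : ℝ)) (gaussianPerp L N) := by simpa using hint
    rw [integrable_const_iff] at this
    simpa using this
  simp only [one_mul, integral_gaussDensity (hl _), Finset.prod_const_one] at h
  constructor
  simpa [Measure.real, ENNReal.toReal_eq_one_iff] using h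

/-- What the moment estimates need of a centred Gaussian measure with independent coordinates of
variances `s i`: polynomials are integrable and satisfy the Gaussian integration by parts
formula. -/
structure IsSteinMeasure {ι : Type*} (μ : Measure (ι → ℝ)) (s : ι → ℝ) : Prop where
  integrable : ∀ p : MvPolynomial ι ℝ, Integrable (fun u => MvPolynomial.eval u p) μ
  stein : ∀ (i : ι) (p : MvPolynomial ι ℝ),
    ∫ u, MvPolynomial.eval u (MvPolynomial.X i * p) ∂μ
      = s i * ∫ u, MvPolynomial.eval u (MvPolynomial.pderiv i p) ∂μ

theorem isSteinMeasure_gaussianPerp (hL : 0 < L) (hL' : L < 2 * Real.pi) (N : ℕ) :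
    IsSteinMeasure (gaussianPerp L N) (fun k => 1 / eigenvalue L k.1) := by
  classical
  have hl := fun k : modes N => eigenvalue_pos hL hL' (ne_zero_of_mem_modes k.2)
  have hmono (d : modes N →₀ ℕ) (a : ℝ) (u : modes N → ℝ) :
      MvPolynomial.eval u (MvPolynomial.monomial d a) = a * ∏ k, u k ^ d k := by
    rw [MvPolynomial.eval_monomial, Finsupp.prod_fintype _ _ (by simp)]
  have hint (p : MvPolynomial (modes N) ℝ) :
      Integrable (fun u => MvPolynomial.eval u p) (gaussianPerp L N) := by
    induction p using MvPolynomial.induction_on' with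
    | monomial d a =>
      simp only [hmono]
      exact (integrable_gaussianPerp_prod (f := fun k x => x ^ d k)
        fun k => integrable_gaussDensity_mul_pow (hl k) _).const_mul a
    | add p q hp hq => simp only [map_add]; exact hp.add hq
  have hmom (d : modes N →₀ ℕ) : ∫ u, ∏ k, u k ^ d k ∂(gaussianPerp L N)
      = ∏ k, ∫ x, x ^ d k * gaussDensity (eigenvalue L k.1) x :=
    integral_gaussianPerp_prod (f := fun k x => x ^ d k)
  have hadd (p q : MvPolynomial (modes N) ℝ) :
      ∫ u, MvPolynomial.eval u (p + q) ∂(gaussianPerp L N)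
        = ∫ u, MvPolynomial.eval u p ∂(gaussianPerp L N)
          + ∫ u, MvPolynomial.eval u q ∂(gaussianPerp L N) := by
    rw [← integral_add (hint p) (hint q)]
    simp only [map_add]
  refine ⟨hint, fun i p => ?_⟩
  induction p using MvPolynomial.induction_on' with
  | monomial d a =>
    rw [MvPolynomial.pderiv_monomial, mul_comm, MvPolynomial.X, MvPolynomial.monomial_mul, mul_one]
    simp only [hmono, integral_const_mul]
    rw [hmom, hmom, ← Finset.mul_prod_erase _ _ (Finset.mem_univ i),
      ← Finset.mul_prod_erase _ _ (Finset.mem_univ i)]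
    have hp : ∀ k ∈ Finset.univ.erase i,
        (∫ x, x ^ (d + Finsupp.single i 1 : modes N →₀ ℕ) k * gaussDensity (eigenvalue L k.1) x)
          = ∫ x, x ^ (d - Finsupp.single i 1 : modes N →₀ ℕ) k * gaussDensity (eigenvalue L k.1) x := by
      intro k hk
      have : i ≠ k := (Finset.ne_of_mem_erase hk).symm
      simp [Finsupp.single_eq_of_ne' this]
    rw [Finset.prod_congr rfl hp]
    simp only [Finsupp.add_apply, Finsupp.tsub_apply, Finsupp.single_eq_same]
    rw [integral_pow_succ_gaussDensity (hl i)]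
    ring
  | add p q hp hq => rw [mul_add, map_add, hadd, hadd, hp, hq, mul_add]

end Product

/-! ### Wick polynomials over an algebra and their moments -/

section Wick

variable {ι A : Type*} [Fintype ι] [CommRing A]

/-- Hermite polynomials with variance `c`, as elements of an algebra in which the variance
need not be a scalar. -/
def hermiteElem (x c : A) : ℕ → A
  | 0 => 1
  | 1 => x
  | n + 2 => x * hermiteElem x c (n + 1) - ((n + 1 : ℕ) : A) * c * hermiteElem x c n

theorem map_hermiteElem {B : Type*} [CommRing B] (f : A →+* B) (x c : A) (n : ℕ) :
    f (hermiteElem x c n) = hermiteElem (f x) (f c) n := by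
  induction n using Nat.twoStepInduction with
  | zero => simp [hermiteElem]
  | one => simp [hermiteElem]
  | more n h1 h2 => simp only [hermiteElem, map_sub, map_mul, map_natCast, h1, h2]

/-- The Hermite polynomials form an Appell sequence: `H_{n+1}' = (n+1) H_n`. -/
theorem derivative_hermitePoly (c : ℝ) (n : ℕ) :
    Polynomial.derivative (hermitePoly c (n + 1))
      = Polynomial.C ((n + 1 : ℕ) : ℝ) * hermitePoly c n := by
  induction n with
  | zero => simp [hermitePoly]
  | succ n ih =>
    have h : hermitePoly c (n + 1 + 1) = Polynomial.X * hermitePoly c (n + 1)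
      - Polynomial.C c * Polynomial.derivative (hermitePoly c (n + 1)) := rfl
    have h' : hermitePoly c (n + 1) = Polynomial.X * hermitePoly c n
      - Polynomial.C c * Polynomial.derivative (hermitePoly c n) := rfl
    rw [h, ih]
    simp only [Polynomial.derivative_sub, Polynomial.derivative_mul, Polynomial.derivative_X,
      Polynomial.derivative_C, ih]
    push_cast [map_add, map_one]
    rw [h']
    ring

theorem eval_hermitePoly (c x : ℝ) (n : ℕ) :
    (hermitePoly c n).eval x = hermiteElem x c n := by
  induction n using Nat.twoStepInduction with
  | zero => simp [hermiteElem, hermitePoly]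
  | one => simp [hermiteElem, hermitePoly]
  | more n h1 h2 =>
    have h : hermitePoly c (n + 2) = Polynomial.X * hermitePoly c (n + 1)
      - Polynomial.C c * Polynomial.derivative (hermitePoly c (n + 1)) := rfl
    rw [h, derivative_hermitePoly, hermiteElem, ← h1, ← h2]
    simp only [Polynomial.eval_sub, Polynomial.eval_mul, Polynomial.eval_X, Polynomial.eval_C]
    ring

variable [Algebra ℝ A]

/-- The Wick polynomial `Λ (b H_n(∑ u_i a_i, ∑ s_i a_i²))` of the variables `u`, for a linear
functional `Λ` (an integral, in the applications) on an algebra containing the `a_i`. It is defined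
by the three-term recurrence of the `H_n`, so as to be visibly a polynomial in `u`; see
`eval_wickPoly` for the closed form. -/
def wickPoly (s : ι → ℝ) (a : ι → A) (Λ : A →ₗ[ℝ] ℝ) : ℕ → A → MvPolynomial ι ℝ
  | 0, b => MvPolynomial.C (Λ b)
  | 1, b => ∑ i, MvPolynomial.X i * MvPolynomial.C (Λ (b * a i))
  | n + 2, b => ∑ i, MvPolynomial.X i * wickPoly s a Λ (n + 1) (b * a i)
      - MvPolynomial.C ((n + 1 : ℕ) : ℝ) * wickPoly s a Λ n (b * ∑ i, s i • a i ^ 2)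

variable (s : ι → ℝ) (a : ι → A) (Λ : A →ₗ[ℝ] ℝ)

theorem wickPoly_succ (n : ℕ) (b : A) :
    wickPoly s a Λ (n + 1) b = ∑ i, MvPolynomial.X i * wickPoly s a Λ n (b * a i)
      - MvPolynomial.C (n : ℝ) * wickPoly s a Λ (n - 1) (b * ∑ i, s i • a i ^ 2) := by
  cases n with
  | zero => simp [wickPoly]
  | succ n => rfl

theorem wickPoly_sum {κ : Type*} (t : Finset κ) (r : κ → ℝ) (b : κ → A) (n : ℕ) :
    wickPoly s a Λ n (∑ k ∈ t, r k • b k)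
      = ∑ k ∈ t, MvPolynomial.C (r k) * wickPoly s a Λ n (b k) := by
  induction n using Nat.twoStepInduction generalizing b with
  | zero => simp [wickPoly, map_sum]
  | one =>
    simp only [wickPoly, Finset.sum_mul, smul_mul_assoc, map_sum, map_smul, smul_eq_mul, map_mul,
      Finset.mul_sum]
    rw [Finset.sum_comm]
    refine Finset.sum_congr rfl fun k _ => Finset.sum_congr rfl fun i _ => by ring
  | more n h1 h2 =>
    have h (c : A) : (∑ k ∈ t, r k • b k) * c = ∑ k ∈ t, r k • (b k * c) := by
      simp only [Finset.sum_mul, smul_mul_assoc]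
    simp only [wickPoly, h, h1, h2]
    generalize ∑ i, s i • a i ^ 2 = c
    simp only [mul_sub, Finset.sum_sub_distrib]
    refine congrArg₂ (· - ·) ?_ ?_
    · simp only [Finset.mul_sum, mul_left_comm (MvPolynomial.C _)]
      exact Finset.sum_comm
    · rw [Finset.mul_sum]
      exact Finset.sum_congr rfl fun k _ => mul_left_comm _ _ _

/-- Differentiating a Wick polynomial lowers its degree and multiplies its kernel by a mode. -/
theorem pderiv_wickPoly (i : ι) (n : ℕ) (b : A) :
    MvPolynomial.pderiv i (wickPoly s a Λ n b)
      = MvPolynomial.C (n : ℝ) * wickPoly s a Λ (n - 1) (b * a i) := by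
  classical
  induction n using Nat.twoStepInduction generalizing b with
  | zero => simp [wickPoly]
  | one =>
    simp [wickPoly, MvPolynomial.pderiv_X, Pi.single_apply]
  | more n h1 h2 =>
    simp only [wickPoly, map_sub, map_sum, MvPolynomial.pderiv_mul, MvPolynomial.pderiv_X, h1, h2,
      MvPolynomial.pderiv_C, zero_mul, zero_add, Finset.sum_add_distrib,
      Nat.add_one_sub_one]
    have h3 : ∑ j, (Pi.single i (1 : MvPolynomial ι ℝ) : ι → MvPolynomial ι ℝ) j
        * wickPoly s a Λ (n + 1) (b * a j) = wickPoly s a Λ (n + 1) (b * a i) := by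
      simp [Pi.single_apply]
    have h4 : wickPoly s a Λ (n + 1) (b * a i)
        = ∑ j, MvPolynomial.X j * wickPoly s a Λ n (b * a j * a i)
          - MvPolynomial.C (n : ℝ) * wickPoly s a Λ (n - 1) (b * (∑ i, s i • a i ^ 2) * a i) := by
      rw [wickPoly_succ, mul_right_comm b (a i)]
      simp only [mul_right_comm b (a i)]
    have h5 : ∑ j, MvPolynomial.X j * (MvPolynomial.C ((n + 1 : ℕ) : ℝ)
          * wickPoly s a Λ n (b * a j * a i))
        = MvPolynomial.C ((n + 1 : ℕ) : ℝ)
          * ∑ j, MvPolynomial.X j * wickPoly s a Λ n (b * a j * a i) := by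
      rw [Finset.mul_sum]
      exact Finset.sum_congr rfl fun j _ => by ring
    have h6 : MvPolynomial.C ((n + 2 : ℕ) : ℝ) = (1 + MvPolynomial.C ((n + 1 : ℕ) : ℝ) :
        MvPolynomial ι ℝ) := by
      rw [← MvPolynomial.C_1, ← map_add]
      push_cast
      ring_nf
    rw [h3, h5, h6, add_mul, one_mul]
    nth_rewrite 3 [h4]
    ring

/-- The Wick polynomials are eigenfunctions of the Ornstein-Uhlenbeck operator. -/
theorem wickPoly_eigen (n : ℕ) (b : A) :
    MvPolynomial.C ((n : ℝ) + 1) * wickPoly s a Λ (n + 1) b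
      = ∑ i, MvPolynomial.X i * MvPolynomial.pderiv i (wickPoly s a Λ (n + 1) b)
        - ∑ i, MvPolynomial.C (s i) * MvPolynomial.pderiv i
            (MvPolynomial.pderiv i (wickPoly s a Λ (n + 1) b)) := by
  have h : wickPoly s a Λ (n - 1) (b * ∑ i, s i • a i ^ 2)
      = ∑ i, MvPolynomial.C (s i) * wickPoly s a Λ (n - 1) (b * a i * a i) := by
    rw [← wickPoly_sum, Finset.mul_sum]
    congr 1
    exact Finset.sum_congr rfl fun i _ => by rw [mul_smul_comm, sq, mul_assoc]
  simp only [pderiv_wickPoly, MvPolynomial.pderiv_C_mul, Nat.add_sub_cancel]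
  rw [wickPoly_succ, h, mul_sub, Finset.mul_sum, Finset.mul_sum, Finset.mul_sum]
  push_cast
  congr 1
  · exact Finset.sum_congr rfl fun i _ => by ring
  · exact Finset.sum_congr rfl fun i _ => by ring

theorem eval_wickPoly (n : ℕ) (b : A) (u : ι → ℝ) :
    MvPolynomial.eval u (wickPoly s a Λ n b)
      = Λ (b * hermiteElem (∑ i, u i • a i) (∑ i, s i • a i ^ 2) n) := by
  induction n using Nat.twoStepInduction generalizing b with
  | zero => simp [wickPoly, hermiteElem]
  | one => simp [wickPoly, hermiteElem, Finset.mul_sum, map_sum]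
  | more n h1 h2 =>
    simp only [wickPoly, hermiteElem, map_sub, map_sum, map_mul, MvPolynomial.eval_X,
      MvPolynomial.eval_C, h1, h2]
    generalize hermiteElem (∑ i, u i • a i) (∑ i, s i • a i ^ 2) (n + 1) = H₁
    generalize hermiteElem (∑ i, u i • a i) (∑ i, s i • a i ^ 2) n = H₀
    generalize ∑ i, s i • a i ^ 2 = c
    rw [mul_sub, map_sub, Finset.sum_mul, Finset.mul_sum, map_sum]
    congr 1
    · refine Finset.sum_congr rfl fun i _ => ?_
      rw [smul_mul_assoc, mul_smul_comm, map_smul, smul_eq_mul, mul_assoc]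
    · rw [← smul_eq_mul, ← map_smul, Nat.cast_smul_eq_nsmul, nsmul_eq_mul]
      congr 1
      ring

/-- The weighted square norm of the kernel of a Wick polynomial. -/
def kernelSum : ℕ → A → ℝ
  | 0, b => Λ b ^ 2
  | n + 1, b => ∑ i, s i * kernelSum n (b * a i)

theorem kernelSum_nonneg (hs : ∀ i, 0 ≤ s i) (n : ℕ) (b : A) : 0 ≤ kernelSum s a Λ n b := by
  induction n generalizing b with
  | zero => exact sq_nonneg _
  | succ n ih => exact Finset.sum_nonneg fun i _ => mul_nonneg (hs i) (ih _)

theorem kernelSum_eq (n : ℕ) (b : A) :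
    kernelSum s a Λ n b
      = ∑ v : Fin n → ι, (∏ j, s (v j)) * Λ (b * ∏ j, a (v j)) ^ 2 := by
  induction n generalizing b with
  | zero => simp [kernelSum]
  | succ n ih =>
    simp only [kernelSum, ih]
    rw [← (Fin.consEquiv fun _ : Fin (n + 1) => ι).sum_comp, Fintype.sum_prod_type]
    refine Finset.sum_congr rfl fun i _ => ?_
    rw [Finset.mul_sum]
    refine Finset.sum_congr rfl fun v _ => ?_
    simp only [Fin.consEquiv, Equiv.coe_fn_mk, Fin.prod_univ_succ, Fin.cons_zero, Fin.cons_succ]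
    rw [mul_assoc (s i), mul_assoc b]

end Wick

/-- Young's inequality with the exponents `(m+1)/m` and `m+1`. -/
theorem succ_mul_pow_mul_le {x y : ℝ} (hx : 0 ≤ x) (hy : 0 ≤ y) (m : ℕ) :
    (m + 1) * (x ^ m * y) ≤ m * x ^ (m + 1) + y ^ (m + 1) := by
  rcases hx.eq_or_lt with rfl | hx
  · rcases m with _ | m
    · simp
    · simp only [ne_eq, Nat.succ_ne_zero, not_false_eq_true, zero_pow, zero_mul, mul_zero, zero_add]
      positivity
  · have h := one_add_mul_le_pow (a := y / x - 1) (by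
      have : 0 ≤ y / x := by positivity
      linarith) (m + 1)
    rw [add_sub_cancel, div_pow, le_div_iff₀ (by positivity)] at h
    have h2 : (1 + ((m + 1 : ℕ) : ℝ) * (y / x - 1)) * x ^ (m + 1)
        = (m + 1) * (x ^ m * y) - m * x ^ (m + 1) := by
      push_cast
      field_simp
      ring
    linarith

section Moments

variable {ι A : Type*} [Fintype ι] [CommRing A] [Algebra ℝ A]
variable {s : ι → ℝ} {μ : Measure (ι → ℝ)}

/-- Integration by parts, applied to the eigenvalue equation `wickPoly_eigen`, expresses the even
moments of a Wick polynomial through its derivatives, which have lower degree. -/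
theorem IsSteinMeasure.integral_wickPoly_pow (hμ : IsSteinMeasure μ s) (a : ι → A)
    (Λ : A →ₗ[ℝ] ℝ) (n m : ℕ) (b : A) :
    ∫ u, MvPolynomial.eval u (wickPoly s a Λ (n + 1) b) ^ (2 * (m + 1)) ∂μ
      = (2 * m + 1) * (n + 1) * ∑ i, s i *
        ∫ u, MvPolynomial.eval u (wickPoly s a Λ (n + 1) b) ^ (2 * m)
          * MvPolynomial.eval u (wickPoly s a Λ n (b * a i)) ^ 2 ∂μ := by
  set F := wickPoly s a Λ (n + 1) b with hF
  have hsum (p : ι → MvPolynomial ι ℝ) : ∫ u, MvPolynomial.eval u (∑ i, p i) ∂μ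
      = ∑ i, ∫ u, MvPolynomial.eval u (p i) ∂μ := by
    simp only [map_sum]
    exact integral_finsetSum _ fun i _ => hμ.integrable (p i)
  have hadd (p q : MvPolynomial ι ℝ) : ∫ u, MvPolynomial.eval u (p + q) ∂μ
      = ∫ u, MvPolynomial.eval u p ∂μ + ∫ u, MvPolynomial.eval u q ∂μ := by
    simp only [map_add]
    exact integral_add (hμ.integrable p) (hμ.integrable q)
  have hC (c : ℝ) (p : MvPolynomial ι ℝ) : ∫ u, MvPolynomial.eval u (MvPolynomial.C c * p) ∂μ
      = c * ∫ u, MvPolynomial.eval u p ∂μ := by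
    simp only [map_mul, MvPolynomial.eval_C, integral_const_mul]
  set D := fun i => MvPolynomial.pderiv i F with hD
  have hDi (i : ι) : D i = MvPolynomial.C ((n : ℝ) + 1) * wickPoly s a Λ n (b * a i) := by
    simp only [hD, hF, pderiv_wickPoly]
    push_cast
    rfl
  -- the eigenvalue equation multiplied by `F ^ (2 m + 1)`
  have h1 : MvPolynomial.C ((n : ℝ) + 1) * F ^ (2 * (m + 1))
      + ∑ i, MvPolynomial.C (s i) * (MvPolynomial.pderiv i (D i) * F ^ (2 * m + 1))
      = ∑ i, MvPolynomial.X i * (D i * F ^ (2 * m + 1)) := by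
    have h := congrArg (· * F ^ (2 * m + 1)) (wickPoly_eigen s a Λ n b)
    simp only [← hF, sub_mul, Finset.sum_mul] at h
    have e : MvPolynomial.C ((n : ℝ) + 1) * F ^ (2 * (m + 1))
      = MvPolynomial.C ((n : ℝ) + 1) * F * F ^ (2 * m + 1) := by ring
    rw [e, h]
    simp only [hD, mul_assoc, sub_add_cancel]
  have h2 (i : ι) : MvPolynomial.pderiv i (D i * F ^ (2 * m + 1))
      = MvPolynomial.pderiv i (D i) * F ^ (2 * m + 1)
        + MvPolynomial.C ((2 * m + 1) * ((n : ℝ) + 1) ^ 2)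
          * (F ^ (2 * m) * wickPoly s a Λ n (b * a i) ^ 2) := by
    rw [MvPolynomial.pderiv_mul, MvPolynomial.pderiv_pow, show MvPolynomial.pderiv i F = D i from rfl]
    nth_rewrite 2 3 [hDi i]
    simp only [map_mul, map_pow, Nat.add_sub_cancel, map_add, map_one, map_natCast, map_ofNat]
    push_cast
    ring
  have h3 := congrArg (fun p => ∫ u, MvPolynomial.eval u p ∂μ) h1
  simp only [hadd, hsum, hC, hμ.stein, h2] at h3
  simp only [mul_add (s _), Finset.sum_add_distrib] at h3
  have h4 : ((n : ℝ) + 1) * ∫ u, MvPolynomial.eval u (F ^ (2 * (m + 1))) ∂μ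
      = ∑ i, s i * ((2 * m + 1) * ((n : ℝ) + 1) ^ 2
        * ∫ u, MvPolynomial.eval u (F ^ (2 * m) * wickPoly s a Λ n (b * a i) ^ 2) ∂μ) := by
    linarith
  have hn : (n : ℝ) + 1 ≠ 0 := by positivity
  simp only [map_mul, map_pow] at h4
  refine mul_left_cancel₀ hn (h4.trans ?_)
  rw [Finset.mul_sum, Finset.mul_sum]
  exact Finset.sum_congr rfl fun i _ => by ring

/-- Hypercontractive bound for the even moments of a Wick polynomial. -/
theorem IsSteinMeasure.integral_wickPoly_pow_le [IsProbabilityMeasure μ]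
    (hμ : IsSteinMeasure μ s) (hs : ∀ i, 0 ≤ s i) (a : ι → A) (Λ : A →ₗ[ℝ] ℝ) (n m : ℕ) (b : A)
    {B : ℝ} (hB : n.factorial * (2 * m + 1) ^ n * kernelSum s a Λ n b < B) :
    ∫ u, MvPolynomial.eval u (wickPoly s a Λ n b) ^ (2 * (m + 1)) ∂μ ≤ B ^ (m + 1) := by
  induction n generalizing b B with
  | zero =>
    simp only [wickPoly, MvPolynomial.eval_C, integral_const, probReal_univ, one_smul]
    simp only [Nat.factorial_zero, Nat.cast_one, pow_zero, one_mul, kernelSum] at hB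
    rw [pow_mul]
    gcongr
  | succ n ih =>
    set κ : ℝ := (2 * m + 1) * (n + 1) with hκ
    have hκ0 : 0 ≤ κ := by positivity
    set T : ι → ℝ := fun i => n.factorial * (2 * m + 1) ^ n * kernelSum s a Λ n (b * a i) with hT
    have hT0 (i : ι) : 0 ≤ T i := mul_nonneg (by positivity) (kernelSum_nonneg s a Λ hs n _)
    have hTsum : (n + 1).factorial * (2 * m + 1) ^ (n + 1) * kernelSum s a Λ (n + 1) b
        = κ * ∑ i, s i * T i := by
      rw [kernelSum, Nat.factorial_succ, Finset.mul_sum, Finset.mul_sum]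
      refine Finset.sum_congr rfl fun i _ => ?_
      rw [hT, hκ]
      push_cast
      ring
    rw [hTsum] at hB
    have hS0 : 0 ≤ ∑ i, s i := Finset.sum_nonneg fun i _ => hs i
    -- strict room for the kernel norms of the derivatives
    set δ := (B - κ * ∑ i, s i * T i) / (κ * ∑ i, s i + 1) with hδ
    have hden : 0 < κ * ∑ i, s i + 1 := by positivity
    have hδ0 : 0 < δ := div_pos (sub_pos.2 hB) hden
    have hB0 : 0 < B := lt_of_le_of_lt
      (mul_nonneg hκ0 (Finset.sum_nonneg fun i _ => mul_nonneg (hs i) (hT0 i))) hB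
    have hBsum : κ * ∑ i, s i * (T i + δ) ≤ B := by
      have h1 : δ * (κ * ∑ i, s i + 1) = B - κ * ∑ i, s i * T i := div_mul_cancel₀ _ hden.ne'
      simp only [mul_add, Finset.sum_add_distrib, ← Finset.sum_mul]
      linarith
    set F := fun u => MvPolynomial.eval u (wickPoly s a Λ (n + 1) b) with hF
    set G := fun i u => MvPolynomial.eval u (wickPoly s a Λ n (b * a i)) with hG
    set x := ∫ u, F u ^ (2 * (m + 1)) ∂μ with hx
    have hFint : Integrable (fun u => F u ^ (2 * (m + 1))) μ := by
      simpa only [map_pow] using hμ.integrable (wickPoly s a Λ (n + 1) b ^ (2 * (m + 1)))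
    have hGint (i : ι) : Integrable (fun u => G i u ^ (2 * (m + 1))) μ := by
      simpa only [map_pow] using hμ.integrable (wickPoly s a Λ n (b * a i) ^ (2 * (m + 1)))
    have hFG (i : ι) : Integrable (fun u => F u ^ (2 * m) * G i u ^ 2) μ := by
      have h := hμ.integrable
        (wickPoly s a Λ (n + 1) b ^ (2 * m) * wickPoly s a Λ n (b * a i) ^ 2)
      simp only [map_pow, map_mul] at h
      exact h
    have hy (i : ι) : (m + 1) * ∫ u, F u ^ (2 * m) * G i u ^ 2 ∂μ
        ≤ (T i + δ) / B * (m * x + B ^ (m + 1)) := by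
      have hD : 0 < T i + δ := add_pos_of_nonneg_of_pos (hT0 i) hδ0
      have h1 := ih (b * a i) (B := T i + δ) (by simp only [hT]; linarith)
      have h2 : ∫ u, (m + 1) * (F u ^ (2 * m) * G i u ^ 2) ∂μ
          ≤ ∫ u, ((T i + δ) / B * m * F u ^ (2 * (m + 1))
            + B ^ m / (T i + δ) ^ m * G i u ^ (2 * (m + 1))) ∂μ := by
        refine integral_mono ((hFG i).const_mul _)
          ((hFint.const_mul _).add ((hGint i).const_mul _)) fun u => ?_
        have h := succ_mul_pow_mul_le (x := F u ^ 2 / B) (y := G i u ^ 2 / (T i + δ))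
          (by positivity) (by positivity) m
        have h3 := mul_le_mul_of_nonneg_left h (show 0 ≤ B ^ m * (T i + δ) by positivity)
        simp only [pow_mul, div_pow] at h3 ⊢
        calc (m + 1) * ((F u ^ 2) ^ m * G i u ^ 2)
            = B ^ m * (T i + δ) * ((m + 1) * ((F u ^ 2) ^ m / B ^ m * (G i u ^ 2 / (T i + δ)))) := by
              field_simp
          _ ≤ _ := h3
          _ = _ := by
              simp only [pow_succ]
              field_simp
      rw [integral_const_mul, integral_add (hFint.const_mul _) ((hGint i).const_mul _),
        integral_const_mul, integral_const_mul] at h2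
      refine h2.trans ?_
      have h4 : B ^ m / (T i + δ) ^ m * ∫ u, G i u ^ (2 * (m + 1)) ∂μ
          ≤ B ^ m / (T i + δ) ^ m * (T i + δ) ^ (m + 1) :=
        mul_le_mul_of_nonneg_left h1 (by positivity)
      have h5 : B ^ m / (T i + δ) ^ m * (T i + δ) ^ (m + 1) = (T i + δ) / B * B ^ (m + 1) := by
        simp only [pow_succ]
        field_simp
      rw [h5] at h4
      linarith
    have hx0 : 0 ≤ x := integral_nonneg fun u => by
      simp only [pow_mul]
      positivity
    have hkey : (m + 1) * x ≤ m * x + B ^ (m + 1) := by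
      have h1 : x = κ * ∑ i, s i * ∫ u, F u ^ (2 * m) * G i u ^ 2 ∂μ :=
        hμ.integral_wickPoly_pow a Λ n m b
      calc (m + 1) * x
          = κ * ∑ i, s i * ((m + 1) * ∫ u, F u ^ (2 * m) * G i u ^ 2 ∂μ) := by
            rw [h1, Finset.mul_sum, Finset.mul_sum, Finset.mul_sum]
            exact Finset.sum_congr rfl fun i _ => by ring
        _ ≤ κ * ∑ i, s i * ((T i + δ) / B * (m * x + B ^ (m + 1))) := by
            refine mul_le_mul_of_nonneg_left (Finset.sum_le_sum fun i _ => ?_) hκ0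
            exact mul_le_mul_of_nonneg_left (hy i) (hs i)
        _ = (κ * ∑ i, s i * (T i + δ)) / B * (m * x + B ^ (m + 1)) := by
            rw [Finset.mul_sum, Finset.mul_sum, Finset.sum_div, Finset.sum_mul]
            exact Finset.sum_congr rfl fun i _ => by ring
        _ ≤ 1 * (m * x + B ^ (m + 1)) := by
            gcongr
            exact (div_le_one hB0).2 hBsum
        _ = _ := one_mul _
    linarith

end Moments

/-! ### Lattice sums -/

/-- The norm `max (|k₁|, |k₂|)` of a wave vector. -/
def supNorm (k : ℤ × ℤ) : ℕ := max k.1.natAbs k.2.natAbs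

theorem mem_modes_iff {N : ℕ} {k : ℤ × ℤ} : k ∈ modes N ↔ k ≠ 0 ∧ supNorm k ≤ N := by
  simp only [modes, Finset.mem_filter, Finset.mem_product, Finset.mem_Icc, supNorm]
  rw [and_comm]
  refine and_congr_right fun _ => ?_
  omega

theorem modes_mono {M N : ℕ} (h : M ≤ N) : modes M ⊆ modes N := fun k hk => by
  rw [mem_modes_iff] at hk ⊢
  exact ⟨hk.1, hk.2.trans h⟩

theorem one_le_supNorm {k : ℤ × ℤ} (hk : k ≠ 0) : 1 ≤ supNorm k := by
  by_contra h
  refine hk (Prod.ext ?_ ?_) <;> simp only [supNorm] at h <;> simp <;> omega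

/-- There are `8 m` wave vectors of norm `m`. -/
theorem sum_modes_supNorm (N : ℕ) (f : ℕ → ℝ) :
    ∑ k ∈ modes N, f (supNorm k) = ∑ m ∈ Finset.Icc 1 N, 8 * m * f m := by
  rw [← Finset.sum_fiberwise_of_maps_to (g := supNorm) (t := Finset.Icc 1 N)
    (fun k hk => by
      rw [mem_modes_iff] at hk
      exact Finset.mem_Icc.2 ⟨one_le_supNorm hk.1, hk.2⟩)]
  refine Finset.sum_congr rfl fun m hm => ?_
  rw [Finset.mem_Icc] at hm
  have hbox : (modes N).filter (fun k => supNorm k = m) = Finset.box m := by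
    ext k
    rw [Finset.mem_filter, mem_modes_iff, Int.mem_box]
    refine ⟨fun h => h.2, fun h => ⟨⟨?_, ?_⟩, h⟩⟩
    · rintro rfl
      simp at h
      omega
    · exact (le_of_eq h).trans hm.2
  rw [Finset.sum_congr hbox (g := fun _ => f m) (fun k hk => by
    rw [Int.mem_box] at hk
    rw [← hk, supNorm]), Finset.sum_const, Int.card_box (by omega), nsmul_eq_mul]
  push_cast
  ring

theorem supNorm_sq_le (k : ℤ × ℤ) : (supNorm k : ℝ) ^ 2 ≤ (k.1 : ℝ) ^ 2 + (k.2 : ℝ) ^ 2 := by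
  have h1 : ((k.1.natAbs : ℕ) : ℝ) ^ 2 = (k.1 : ℝ) ^ 2 := by
    rw [Nat.cast_natAbs, Int.cast_abs, sq_abs]
  have h2 : ((k.2.natAbs : ℕ) : ℝ) ^ 2 = (k.2 : ℝ) ^ 2 := by
    rw [Nat.cast_natAbs, Int.cast_abs, sq_abs]
  rw [← h1, ← h2, supNorm]
  rcases max_choice k.1.natAbs k.2.natAbs with h | h <;> rw [h]
  · exact le_add_of_nonneg_right (sq_nonneg _)
  · exact le_add_of_nonneg_left (sq_nonneg _)

theorem exists_inv_eigenvalue_le {L : ℝ} (hL : 0 < L) (hL' : L < 2 * Real.pi) :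
    ∃ c : ℝ, 0 < c ∧ ∀ k : ℤ × ℤ, k ≠ 0 → 1 / eigenvalue L k ≤ c / (supNorm k : ℝ) ^ 2 := by
  have h0 := sub_pos.2 (one_lt_frequency_sq hL hL')
  refine ⟨1 / ((2 * Real.pi / L) ^ 2 - 1), by positivity, fun k hk => ?_⟩
  have hm : (0 : ℝ) < supNorm k := by exact_mod_cast one_le_supNorm hk
  rw [div_div]
  refine one_div_le_one_div_of_le (by positivity) ?_
  exact (mul_le_mul_of_nonneg_left (supNorm_sq_le k) h0.le).trans (eigenvalue_ge L hk)

theorem renormConst_nonneg {L : ℝ} (hL : 0 < L) (hL' : L < 2 * Real.pi) (N : ℕ) :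
    0 ≤ renormConst L N :=
  mul_nonneg (by positivity) (Finset.sum_nonneg fun k _ =>
    (one_div_pos.2 (eigenvalue_pos hL hL' (ne_zero_of_mem_modes k.2))).le)

/-- The renormalisation constant diverges at most logarithmically. -/
theorem exists_renormConst_le {L : ℝ} (hL : 0 < L) (hL' : L < 2 * Real.pi) :
    ∃ c : ℝ, 0 < c ∧ ∀ N j : ℕ, N ≤ 2 ^ j → renormConst L N ≤ c * (j + 1) := by
  obtain ⟨c, hc, h⟩ := exists_inv_eigenvalue_le hL hL'
  refine ⟨1 / L ^ 2 * (8 * c), by positivity, fun N j hj => ?_⟩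
  rw [renormConst, mul_assoc (1 / L ^ 2)]
  refine mul_le_mul_of_nonneg_left ?_ (by positivity)
  have h1 : ∑ k : modes N, 1 / eigenvalue L k.1 ≤ 8 * c * ∑ m ∈ Finset.Icc 1 N, ((m : ℝ))⁻¹ := by
    calc ∑ k : modes N, 1 / eigenvalue L k.1
        ≤ ∑ k : modes N, c / (supNorm k.1 : ℝ) ^ 2 :=
          Finset.sum_le_sum fun k _ => h k.1 (ne_zero_of_mem_modes k.2)
      _ = ∑ k ∈ modes N, c / (supNorm k : ℝ) ^ 2 :=
          Finset.sum_coe_sort (modes N) (fun k => c / (supNorm k : ℝ) ^ 2)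
      _ = ∑ m ∈ Finset.Icc 1 N, 8 * m * (c / (m : ℝ) ^ 2) :=
          sum_modes_supNorm N fun m => c / (m : ℝ) ^ 2
      _ = _ := by
          rw [Finset.mul_sum]
          refine Finset.sum_congr rfl fun m hm => ?_
          have : (m : ℝ) ≠ 0 := by
            have := (Finset.mem_Icc.1 hm).1
            positivity
          field_simp
  refine h1.trans (mul_le_mul_of_nonneg_left ?_ (by positivity))
  have h2 := harmonic_le_one_add_log N
  rw [harmonic_eq_sum_Icc] at h2
  push_cast at h2
  refine h2.trans ?_
  rw [add_comm]
  gcongr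
  rcases N.eq_zero_or_pos with rfl | hN
  · simp
  · calc Real.log N ≤ Real.log ((2 : ℝ) ^ j) :=
          Real.log_le_log (by exact_mod_cast hN) (by exact_mod_cast hj)
      _ = j * Real.log 2 := by rw [Real.log_pow]
      _ ≤ j * 1 := by
          gcongr
          linarith [Real.log_two_lt_d9]
      _ = j := mul_one _

theorem exists_sum_supNorm_le :
    ∃ S : ℝ, 0 < S ∧ ∀ N : ℕ, ∑ k : modes N, (supNorm k.1 : ℝ) ^ (-(5 / 2) : ℝ) ≤ S := by
  have hs : Summable fun m : ℕ => (m : ℝ) ^ (-(3 / 2) : ℝ) :=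
    Real.summable_nat_rpow.2 (by norm_num)
  have hnn : 0 ≤ ∑' m : ℕ, (m : ℝ) ^ (-(3 / 2) : ℝ) := tsum_nonneg fun m => by positivity
  refine ⟨8 * ∑' m : ℕ, (m : ℝ) ^ (-(3 / 2) : ℝ) + 1, by positivity, fun N => ?_⟩
  rw [Finset.sum_coe_sort (modes N) (fun k => (supNorm k : ℝ) ^ (-(5 / 2) : ℝ)),
    sum_modes_supNorm N fun m => (m : ℝ) ^ (-(5 / 2) : ℝ)]
  have h : ∀ m ∈ Finset.Icc 1 N, 8 * (m : ℝ) * (m : ℝ) ^ (-(5 / 2) : ℝ)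
      = 8 * (m : ℝ) ^ (-(3 / 2) : ℝ) := fun m hm => by
    have hm : (0 : ℝ) < m := by exact_mod_cast (Finset.mem_Icc.1 hm).1
    rw [mul_assoc]
    nth_rewrite 1 [← Real.rpow_one (m : ℝ)]
    rw [← Real.rpow_add hm]
    norm_num
  rw [Finset.sum_congr rfl h, ← Finset.mul_sum]
  have := hs.sum_le_tsum (Finset.Icc 1 N) (fun m _ => by positivity)
  linarith

/-- A discrete Young inequality: the smallest factor is distributed over the others. -/
theorem prod_rpow_le_sum {n : ℕ} (hn : n ≤ 3) (x : Fin (n + 1) → ℝ) (hx : ∀ j, 1 ≤ x j) :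
    ∏ j, x j ^ (-(15 / 8) : ℝ) ≤ ∑ i, ∏ j, x (Fin.succAbove i j) ^ (-(5 / 2) : ℝ) := by
  obtain ⟨i, -, hi⟩ := Finset.exists_max_image Finset.univ x Finset.univ_nonempty
  have hpos (j) : 0 < x j := zero_lt_one.trans_le (hx j)
  have hi0 : 0 ≤ x i ^ (-(5 / 8) : ℝ) := Real.rpow_nonneg (hpos i).le _
  have h1 : x i ^ (-(15 / 8) : ℝ) ≤ ∏ j, x (Fin.succAbove i j) ^ (-(5 / 8) : ℝ) := by
    calc x i ^ (-(15 / 8) : ℝ) = (x i ^ (-(5 / 8) : ℝ)) ^ 3 := by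
          rw [← Real.rpow_natCast, ← Real.rpow_mul (hpos i).le]
          norm_num
      _ ≤ (x i ^ (-(5 / 8) : ℝ)) ^ n :=
          pow_le_pow_of_le_one hi0 (Real.rpow_le_one_of_one_le_of_nonpos (hx i) (by norm_num)) hn
      _ = ∏ _j : Fin n, x i ^ (-(5 / 8) : ℝ) := by simp
      _ ≤ _ := by
          refine Finset.prod_le_prod (fun _ _ => hi0) fun j _ => ?_
          exact Real.rpow_le_rpow_of_nonpos (hpos _) (hi _ (Finset.mem_univ _)) (by norm_num)
  calc ∏ j, x j ^ (-(15 / 8) : ℝ)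
      = x i ^ (-(15 / 8) : ℝ) * ∏ j, x (Fin.succAbove i j) ^ (-(15 / 8) : ℝ) :=
        Fin.prod_univ_succAbove _ i
    _ ≤ (∏ j, x (Fin.succAbove i j) ^ (-(5 / 8) : ℝ))
          * ∏ j, x (Fin.succAbove i j) ^ (-(15 / 8) : ℝ) := by
        refine mul_le_mul_of_nonneg_right h1 (Finset.prod_nonneg fun j _ => ?_)
        exact Real.rpow_nonneg (hpos _).le _
    _ = ∏ j, x (Fin.succAbove i j) ^ (-(5 / 2) : ℝ) := by
        rw [← Finset.prod_mul_distrib]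
        refine Finset.prod_congr rfl fun j _ => ?_
        rw [← Real.rpow_add (hpos _)]
        norm_num
    _ ≤ _ := Finset.single_le_sum
        (f := fun i => ∏ j, x (Fin.succAbove i j) ^ (-(5 / 2) : ℝ))
        (fun i _ => Finset.prod_nonneg fun j _ => Real.rpow_nonneg (hpos _).le _)
        (Finset.mem_univ i)

open Classical in
/-- Summation over the tuples of wave vectors with a vanishing signed sum loses one variable. -/
theorem sum_signed_le {N n : ℕ} (σ : Fin (n + 1) → ℤ) (hσ : ∀ j, σ j ≠ 0) (i : Fin (n + 1))
    (g : (Fin n → modes N) → ℝ) (hg : ∀ w, 0 ≤ g w) :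
    ∑ v : Fin (n + 1) → modes N, (if ∑ j, σ j • (v j).1 = 0 then
      g (fun j => v (Fin.succAbove i j)) else 0) ≤ ∑ w, g w := by
  rw [← (Fin.insertNthEquiv (fun _ => modes N) i).sum_comp, Fintype.sum_prod_type,
    Finset.sum_comm]
  refine Finset.sum_le_sum fun w _ => ?_
  simp only [Fin.insertNthEquiv_apply, Fin.insertNth_apply_succAbove]
  rw [← Finset.sum_filter, Finset.sum_const, nsmul_eq_mul]
  refine mul_le_of_le_one_left (hg w) ?_
  have : (Finset.univ.filter fun x : modes N =>
      ∑ j, σ j • ((Fin.insertNth i x w : Fin (n + 1) → modes N) j).1 = 0).card ≤ 1 := by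
    refine Finset.card_le_one.2 fun x hx y hy => ?_
    rw [Finset.mem_filter, Fin.sum_univ_succAbove _ i] at hx hy
    simp only [Fin.insertNth_apply_same, Fin.insertNth_apply_succAbove] at hx hy
    have h := add_right_cancel (hx.2.trans hy.2.symm)
    refine Subtype.ext (Prod.ext ?_ ?_)
    · have := congrArg Prod.fst h
      simpa [hσ i] using this
    · have := congrArg Prod.snd h
      simpa [hσ i] using this
  exact_mod_cast this

open Classical in
/-- The tuples that involve a wave vector beyond the cutoff `M` contribute a negative power of
`M + 1`. -/
theorem exists_lattice_sum_le {L : ℝ} (hL : 0 < L) (hL' : L < 2 * Real.pi) (n : ℕ) (hn : n ≤ 3) :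
    ∃ A : ℝ, 0 < A ∧ ∀ (M N : ℕ) (σ : Fin (n + 1) → ℤ), (∀ j, σ j ≠ 0) →
      ∑ v : Fin (n + 1) → modes N, (∏ j, 1 / eigenvalue L (v j).1)
        * (if (∃ j, (v j).1 ∉ modes M) ∧ ∑ j, σ j • (v j).1 = 0 then 1 else 0)
      ≤ A * ((M : ℝ) + 1) ^ (-(1 / 8) : ℝ) := by
  obtain ⟨c, hc, hcl⟩ := exists_inv_eigenvalue_le hL hL'
  obtain ⟨S, hS, hSl⟩ := exists_sum_supNorm_le
  refine ⟨c ^ (n + 1) * ((n + 1) * S ^ n), by positivity, fun M N σ hσ => ?_⟩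
  set X : (Fin (n + 1) → modes N) → Fin (n + 1) → ℝ := fun v j => (supNorm (v j).1 : ℝ) with hX
  have hX1 (v j) : 1 ≤ X v j :=
    Nat.one_le_cast.2 (one_le_supNorm (ne_zero_of_mem_modes (v j).2))
  have hX0 (v j) : 0 < X v j := zero_lt_one.trans_le (hX1 v j)
  set K : ℝ := c ^ (n + 1) * ((M : ℝ) + 1) ^ (-(1 / 8) : ℝ) with hK
  have hK0 : 0 ≤ K := by positivity
  have hpt (v : Fin (n + 1) → modes N) : (∏ j, 1 / eigenvalue L (v j).1)
        * (if (∃ j, (v j).1 ∉ modes M) ∧ ∑ j, σ j • (v j).1 = 0 then 1 else 0)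
      ≤ K * ∑ i, (if ∑ j, σ j • (v j).1 = 0 then
          ∏ j, X v (Fin.succAbove i j) ^ (-(5 / 2) : ℝ) else 0) := by
    by_cases h : ∑ j, σ j • (v j).1 = 0
    · simp only [h, and_true, if_true]
      refine le_trans ?_ (mul_le_mul_of_nonneg_left (prod_rpow_le_sum hn (X v) (hX1 v)) hK0)
      split_ifs with hM
      · obtain ⟨j₀, hj₀⟩ := hM
        have hlarge : (M : ℝ) + 1 ≤ X v j₀ := by
          rw [mem_modes_iff, not_and] at hj₀
          have := hj₀ (ne_zero_of_mem_modes (v j₀).2)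
          have : M + 1 ≤ supNorm (v j₀).1 := by omega
          simp only [hX]
          exact_mod_cast this
        have hM1 : (1 : ℝ) ≤ ((M : ℝ) + 1) ^ (-(1 / 8) : ℝ) * ∏ j, X v j ^ (1 / 8 : ℝ) := by
          have h1 : ((M : ℝ) + 1) ^ (1 / 8 : ℝ) ≤ ∏ j, X v j ^ (1 / 8 : ℝ) := by
            refine (Real.rpow_le_rpow (by positivity) hlarge (by norm_num)).trans ?_
            rw [← Finset.mul_prod_erase _ _ (Finset.mem_univ j₀)]
            refine le_mul_of_one_le_right (Real.rpow_nonneg (hX0 v j₀).le _) ?_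
            exact Finset.prod_induction _ (fun x : ℝ => 1 ≤ x)
              (fun _ _ => one_le_mul_of_one_le_of_one_le) le_rfl
              fun _ _ => Real.one_le_rpow (hX1 v _) (by norm_num)
          calc (1 : ℝ) = ((M : ℝ) + 1) ^ (-(1 / 8) : ℝ) * ((M : ℝ) + 1) ^ (1 / 8 : ℝ) := by
                rw [← Real.rpow_add (by positivity)]
                simp
            _ ≤ _ := by gcongr
        have hprod : ∏ j, 1 / eigenvalue L (v j).1 ≤ c ^ (n + 1) * ∏ j, X v j ^ (-2 : ℝ) := by
          calc ∏ j, 1 / eigenvalue L (v j).1 ≤ ∏ j, (c * X v j ^ (-2 : ℝ)) := by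
                refine Finset.prod_le_prod (fun j _ => (one_div_pos.2
                  (eigenvalue_pos hL hL' (ne_zero_of_mem_modes (v j).2))).le) fun j _ => ?_
                refine (hcl _ (ne_zero_of_mem_modes (v j).2)).trans (le_of_eq ?_)
                rw [Real.rpow_neg (hX0 v j).le, div_eq_mul_inv, Real.rpow_two]
            _ = _ := by rw [Finset.prod_mul_distrib]; simp
        have hp0 : 0 ≤ c ^ (n + 1) * ∏ j, X v j ^ (-2 : ℝ) :=
          mul_nonneg (by positivity) (Finset.prod_nonneg fun j _ => Real.rpow_nonneg (hX0 v j).le _)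
        calc (∏ j, 1 / eigenvalue L (v j).1) * 1
            ≤ (c ^ (n + 1) * ∏ j, X v j ^ (-2 : ℝ))
              * (((M : ℝ) + 1) ^ (-(1 / 8) : ℝ) * ∏ j, X v j ^ (1 / 8 : ℝ)) :=
              mul_le_mul hprod hM1 zero_le_one hp0
          _ = K * ∏ j, (X v j ^ (-2 : ℝ) * X v j ^ (1 / 8 : ℝ)) := by
              rw [Finset.prod_mul_distrib, hK]
              ring
          _ = K * ∏ j, X v j ^ (-(15 / 8) : ℝ) := by
              congr 1
              refine Finset.prod_congr rfl fun j _ => ?_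
              rw [← Real.rpow_add (hX0 v j)]
              norm_num
      · rw [mul_zero]
        exact mul_nonneg hK0 (Finset.prod_nonneg fun j _ => Real.rpow_nonneg (hX0 v j).le _)
    · simp only [h, and_false, if_false, mul_zero, Finset.sum_const_zero, le_refl]
  refine (Finset.sum_le_sum fun v _ => hpt v).trans ?_
  rw [← Finset.mul_sum, Finset.sum_comm]
  have hi (i : Fin (n + 1)) : ∑ v : Fin (n + 1) → modes N, (if ∑ j, σ j • (v j).1 = 0 then
      ∏ j, X v (Fin.succAbove i j) ^ (-(5 / 2) : ℝ) else 0) ≤ S ^ n := by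
    refine (sum_signed_le σ hσ i (fun w => ∏ j, (supNorm (w j).1 : ℝ) ^ (-(5 / 2) : ℝ))
      (fun w => Finset.prod_nonneg fun j _ => Real.rpow_nonneg (Nat.cast_nonneg _) _)).trans ?_
    rw [← Fintype.sum_pow (fun k : modes N => (supNorm k.1 : ℝ) ^ (-(5 / 2) : ℝ)) n]
    exact pow_le_pow_left₀ (Finset.sum_nonneg fun k _ => Real.rpow_nonneg (Nat.cast_nonneg _) _)
      (hSl N) n
  calc K * ∑ i, _ ≤ K * ∑ _i : Fin (n + 1), S ^ n :=
        mul_le_mul_of_nonneg_left (Finset.sum_le_sum fun i _ => hi i) hK0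
    _ = _ := by
        rw [Finset.sum_const, Finset.card_univ, Fintype.card_fin, nsmul_eq_mul, hK]
        push_cast
        ring

/-! ### Integrals of products of Fourier modes -/

/-- The fundamental cell of the torus of side `L`. -/
def cell (L : ℝ) : Set (ℝ × ℝ) := Set.Ioc (0 : ℝ) L ×ˢ Set.Ioc (0 : ℝ) L

theorem integrableOn_cell {E : Type*} [NormedAddCommGroup E] {f : ℝ × ℝ → E} (L : ℝ)
    (hf : Continuous f) : IntegrableOn f (cell L) :=
  (hf.continuousOn.integrableOn_compact (isCompact_Icc.prod isCompact_Icc)).mono_set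
    (Set.prod_mono Set.Ioc_subset_Icc_self Set.Ioc_subset_Icc_self)

theorem continuous_phase (L : ℝ) (k : ℤ × ℤ) : Continuous (phase L k) := by
  unfold phase
  fun_prop

theorem integral_exp_frequency {L : ℝ} (hL : 0 < L) (n : ℤ) :
    ∫ x in Set.Ioc (0 : ℝ) L, Complex.exp (((2 * Real.pi / L * (n * x) : ℝ) : ℂ) * Complex.I)
      = if n = 0 then (L : ℂ) else 0 := by
  rw [← intervalIntegral.integral_of_le hL.le]
  split_ifs with hn
  · simp [hn]
  · have hL' : (L : ℂ) ≠ 0 := by exact_mod_cast hL.ne'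
    have hn' : (n : ℂ) ≠ 0 := by exact_mod_cast hn
    have hc : (n : ℂ) * (2 * Real.pi * Complex.I) / L ≠ 0 := by
      refine div_ne_zero (mul_ne_zero hn' ?_) hL'
      exact Complex.two_pi_I_ne_zero
    have h : ∀ x : ℝ, Complex.exp (((2 * Real.pi / L * (n * x) : ℝ) : ℂ) * Complex.I)
        = Complex.exp ((n : ℂ) * (2 * Real.pi * Complex.I) / L * x) := fun x => by
      congr 1
      push_cast
      ring
    simp only [h]
    rw [integral_exp_mul_complex hc, div_mul_cancel₀ _ hL', Complex.exp_int_mul_two_pi_mul_I]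
    simp

theorem integral_exp_phase {L : ℝ} (hL : 0 < L) (k : ℤ × ℤ) :
    ∫ x in cell L, Complex.exp ((phase L k x : ℂ) * Complex.I)
      = if k = 0 then (L : ℂ) ^ 2 else 0 := by
  have h : ∀ x : ℝ × ℝ, Complex.exp ((phase L k x : ℂ) * Complex.I)
      = Complex.exp (((2 * Real.pi / L * (k.1 * x.1) : ℝ) : ℂ) * Complex.I)
        * Complex.exp (((2 * Real.pi / L * (k.2 * x.2) : ℝ) : ℂ) * Complex.I) := fun x => by
    rw [← Complex.exp_add, phase]
    congr 1
    push_cast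
    ring
  simp only [h, cell]
  rw [Measure.volume_eq_prod, setIntegral_prod_mul
    (fun x : ℝ => Complex.exp (((2 * Real.pi / L * (k.1 * x) : ℝ) : ℂ) * Complex.I))
    (fun x : ℝ => Complex.exp (((2 * Real.pi / L * (k.2 * x) : ℝ) : ℂ) * Complex.I)),
    integral_exp_frequency hL, integral_exp_frequency hL]
  by_cases h1 : k.1 = 0 <;> by_cases h2 : k.2 = 0 <;> simp [h1, h2, Prod.ext_iff, sq]

/-- The sign `±1` coded by a Boolean. -/
def signOf (σ : Bool) : ℤ := if σ then 1 else -1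

theorem signOf_ne_zero (σ : Bool) : signOf σ ≠ 0 := by cases σ <;> simp [signOf]

theorem phase_sum {L : ℝ} {n : ℕ} (k : Fin n → ℤ × ℤ) (x : ℝ × ℝ) :
    phase L (∑ j, k j) x = ∑ j, phase L (k j) x := by
  simp only [phase, Prod.fst_sum, Prod.snd_sum]
  push_cast
  rw [Finset.sum_mul, Finset.sum_mul, ← Finset.sum_add_distrib, Finset.mul_sum]

theorem exists_realMode_eq (L : ℝ) (hL : 0 < L) (k : ℤ × ℤ) :
    ∃ d : Bool → ℂ, (∀ σ, ‖d σ‖ = Real.sqrt 2 / (2 * L)) ∧ ∀ x, (realMode L k x : ℂ)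
      = ∑ σ, d σ * Complex.exp ((phase L (signOf σ • k) x : ℂ) * Complex.I) := by
  have hp (x) : phase L (signOf true • k) x = phase L k x := by simp [signOf]
  have hm (x) : phase L (signOf false • k) x = -phase L k x := by simp [signOf, phase_neg]
  have hnorm : ‖((Real.sqrt 2 / (2 * L) : ℝ) : ℂ)‖ = Real.sqrt 2 / (2 * L) := by
    rw [Complex.norm_real, Real.norm_of_nonneg (by positivity)]
  by_cases hu : IsUpper k
  · refine ⟨fun _ => ((Real.sqrt 2 / (2 * L) : ℝ) : ℂ), fun _ => hnorm, fun x => ?_⟩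
    rw [realMode, if_pos hu, Fintype.sum_bool, hp, hm]
    push_cast
    rw [Complex.cos]
    ring
  · refine ⟨fun σ => ((Real.sqrt 2 / (2 * L) : ℝ) : ℂ) * (-(signOf σ : ℂ) * Complex.I),
      fun σ => ?_, fun x => ?_⟩
    · rw [norm_mul, hnorm]
      cases σ <;> simp [signOf]
    · rw [realMode, if_neg hu, Fintype.sum_bool, hp, hm]
      push_cast
      rw [Complex.sin]
      simp only [signOf]
      push_cast
      simp
      ring

open Classical in
/-- A product of real modes has mean zero unless some signed sum of the wave vectors vanishes. -/
theorem sq_integral_prod_realMode_le {L : ℝ} (hL : 0 < L) {n : ℕ} (k : Fin n → ℤ × ℤ) :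
    (∫ x in cell L, ∏ j, realMode L (k j) x) ^ 2
      ≤ L ^ 4 / L ^ (2 * n) * ∑ σ : Fin n → Bool, if ∑ j, signOf (σ j) • k j = 0 then 1 else 0 := by
  choose d hd hd' using fun j => exists_realMode_eq L hL (k j)
  have hcont (q : ℤ × ℤ) : Continuous fun x => Complex.exp ((phase L q x : ℂ) * Complex.I) := by
    have := continuous_phase L q
    fun_prop
  have h1 : ((∫ x in cell L, ∏ j, realMode L (k j) x : ℝ) : ℂ)
      = ∑ σ : Fin n → Bool, (∏ j, d j (σ j)) *
          (if ∑ j, signOf (σ j) • k j = 0 then (L : ℂ) ^ 2 else 0) := by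
    rw [← integral_complex_ofReal]
    have h2 (x : ℝ × ℝ) : ((∏ j, realMode L (k j) x : ℝ) : ℂ)
        = ∑ σ : Fin n → Bool, (∏ j, d j (σ j)) *
          Complex.exp ((phase L (∑ j, signOf (σ j) • k j) x : ℂ) * Complex.I) := by
      push_cast
      simp only [hd']
      rw [Finset.prod_univ_sum, Fintype.piFinset_univ]
      refine Finset.sum_congr rfl fun σ _ => ?_
      rw [Finset.prod_mul_distrib, ← Complex.exp_sum, phase_sum, ← Finset.sum_mul]
      push_cast
      rfl
    simp only [h2]
    rw [integral_finsetSum _ fun σ _ => (integrableOn_cell L (hcont _)).const_mul _]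
    refine Finset.sum_congr rfl fun σ _ => ?_
    rw [integral_const_mul, integral_exp_phase hL]
  have h2 : |∫ x in cell L, ∏ j, realMode L (k j) x|
      ≤ ∑ σ : Fin n → Bool, (Real.sqrt 2 / (2 * L)) ^ n * L ^ 2 *
          (if ∑ j, signOf (σ j) • k j = 0 then 1 else 0) := by
    rw [← Real.norm_eq_abs, ← Complex.norm_real, h1]
    refine (norm_sum_le _ _).trans (Finset.sum_le_sum fun σ _ => ?_)
    rw [norm_mul, norm_prod]
    simp only [hd, Finset.prod_const, Finset.card_univ, Fintype.card_fin]
    split_ifs <;> simp [abs_of_pos hL]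
  have h3 := pow_le_pow_left₀ (abs_nonneg _) h2 2
  rw [sq_abs, ← Finset.mul_sum, mul_pow] at h3
  refine h3.trans ?_
  have h4 := sq_sum_le_card_mul_sum_sq (s := (Finset.univ : Finset (Fin n → Bool)))
    (f := fun σ => if ∑ j, signOf (σ j) • k j = 0 then (1 : ℝ) else 0)
  have h5 : ∀ σ : Fin n → Bool, (if ∑ j, signOf (σ j) • k j = 0 then (1 : ℝ) else 0) ^ 2
      = if ∑ j, signOf (σ j) • k j = 0 then (1 : ℝ) else 0 := fun σ => by split_ifs <;> simp
  simp only [h5, Finset.card_univ, Fintype.card_fun, Fintype.card_bool, Fintype.card_fin] at h4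
  refine (mul_le_mul_of_nonneg_left h4 (by positivity)).trans (le_of_eq ?_)
  have h6 : ((Real.sqrt 2 / (2 * L)) ^ n * L ^ 2) ^ 2 * ((2 ^ n : ℕ) : ℝ)
      = L ^ 4 / L ^ (2 * n) := by
    rw [mul_pow, ← pow_mul, mul_comm n 2, pow_mul, div_pow, Real.sq_sqrt (by norm_num), ← pow_mul]
    push_cast
    have : (2 / (2 * L) ^ 2) ^ n * 2 ^ n = (1 / L ^ 2) ^ n := by
      rw [← mul_pow]
      congr 1
      field_simp
    calc (2 / (2 * L) ^ 2) ^ n * L ^ (2 * 2) * 2 ^ n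
        = (2 / (2 * L) ^ 2) ^ n * 2 ^ n * L ^ 4 := by ring
      _ = _ := by
        rw [this, div_pow, one_pow, ← pow_mul]
        ring
  rw [← mul_assoc, h6]

/-! ### Differences of Wick powers at two cutoffs -/

theorem continuous_realMode (L : ℝ) (k : ℤ × ℤ) : Continuous (realMode L k) := by
  have := continuous_phase L k
  unfold realMode
  split_ifs <;> fun_prop

/-- A real mode as an element of the algebra of continuous functions. -/
def modeFun (L : ℝ) (k : ℤ × ℤ) : C(ℝ × ℝ, ℝ) := ⟨realMode L k, continuous_realMode L k⟩

/-- Integration over the fundamental cell. -/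
def cellIntegral (L : ℝ) : C(ℝ × ℝ, ℝ) →ₗ[ℝ] ℝ where
  toFun f := ∫ x in cell L, f x
  map_add' f g := integral_add (integrableOn_cell L f.continuous) (integrableOn_cell L g.continuous)
  map_smul' c _ := integral_const_mul c _

/-- The functional `(f, g) ↦ ∫ f - ∫ g`, which turns the difference of two Wick powers into a
single Wick polynomial over a product algebra. -/
def cellIntegralDiff (L : ℝ) : C(ℝ × ℝ, ℝ) × C(ℝ × ℝ, ℝ) →ₗ[ℝ] ℝ :=
  (cellIntegral L).comp (LinearMap.fst ℝ _ _) - (cellIntegral L).comp (LinearMap.snd ℝ _ _)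

open Classical in
/-- The pair of a mode and of its truncation to the wave vectors of size at most `M`. -/
def modePair (L : ℝ) (M : ℕ) (k : ℤ × ℤ) : C(ℝ × ℝ, ℝ) × C(ℝ × ℝ, ℝ) :=
  (modeFun L k, if k ∈ modes M then modeFun L k else 0)

/-- Restriction of the coordinates to the wave vectors of size at most `M`. -/
def restrictModes {M N : ℕ} (h : M ≤ N) (u : modes N → ℝ) : modes M → ℝ :=
  fun k => u ⟨k.1, modes_mono h k.2⟩

theorem wickIntegral_eq (L : ℝ) {N : ℕ} (n : ℕ) (u : modes N → ℝ) :
    wickIntegral L n u = cellIntegral L (hermiteElem (∑ k : modes N, u k • modeFun L k.1)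
      (∑ k : modes N, (1 / eigenvalue L k.1) • modeFun L k.1 ^ 2) n) := by
  have heval (x : ℝ × ℝ) (f : C(ℝ × ℝ, ℝ)) :
      (Pi.evalRingHom (fun _ : ℝ × ℝ => ℝ) x).comp ContinuousMap.coeFnRingHom f = f x := rfl
  refine integral_congr_ae (.of_forall fun x => ?_)
  simp only
  rw [eval_hermitePoly, ← heval x, map_hermiteElem, field_eq, renormConst_eq N x]
  simp only [heval, ContinuousMap.coe_sum, Finset.sum_apply, ContinuousMap.coe_smul, Pi.smul_apply,
    smul_eq_mul, ContinuousMap.coe_pow, Pi.pow_apply]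
  rfl

theorem sum_restrictModes {E : Type*} [AddCommMonoid E] {M N : ℕ} (h : M ≤ N)
    [DecidablePred (· ∈ modes M)] (f : modes N → E) :
    ∑ k : modes N, (if k.1 ∈ modes M then f k else 0)
      = ∑ k : modes M, f ⟨k.1, modes_mono h k.2⟩ := by
  refine (Fintype.sum_of_injective (fun k : modes M => (⟨k.1, modes_mono h k.2⟩ : modes N))
    (fun k l hkl => ?_) _ _ (fun k hk => ?_) fun k => ?_).symm
  · exact Subtype.ext (congrArg (fun z : modes N => z.1) hkl)
  · rw [if_neg]
    exact fun hk' => hk ⟨⟨k.1, hk'⟩, rfl⟩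
  · rw [if_pos k.2]

theorem wickIntegral_sub_restrict (L : ℝ) {M N : ℕ} (h : M ≤ N) (n : ℕ) (u : modes N → ℝ) :
    wickIntegral L n u - wickIntegral L n (restrictModes h u)
      = MvPolynomial.eval u (wickPoly (fun k : modes N => 1 / eigenvalue L k.1)
          (fun k => modePair L M k.1) (cellIntegralDiff L) n 1) := by
  classical
  rw [eval_wickPoly, one_mul, cellIntegralDiff, LinearMap.sub_apply, LinearMap.comp_apply,
    LinearMap.comp_apply, LinearMap.fst_apply, LinearMap.snd_apply, wickIntegral_eq,
    wickIntegral_eq]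
  have h1 := map_hermiteElem (RingHom.fst C(ℝ × ℝ, ℝ) C(ℝ × ℝ, ℝ))
    (∑ k : modes N, u k • modePair L M k.1)
    (∑ k : modes N, (1 / eigenvalue L k.1) • modePair L M k.1 ^ 2) n
  have h2 := map_hermiteElem (RingHom.snd C(ℝ × ℝ, ℝ) C(ℝ × ℝ, ℝ))
    (∑ k : modes N, u k • modePair L M k.1)
    (∑ k : modes N, (1 / eigenvalue L k.1) • modePair L M k.1 ^ 2) n
  simp only [RingHom.coe_fst, RingHom.coe_snd] at h1 h2
  rw [h1, h2]
  simp only [Prod.fst_sum, Prod.snd_sum, Prod.smul_fst, Prod.smul_snd, Prod.pow_fst, Prod.pow_snd,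
    modePair, ite_pow, smul_ite, smul_zero, ne_eq, OfNat.ofNat_ne_zero, not_false_eq_true,
    zero_pow]
  rw [sum_restrictModes h (fun k => u k • modeFun L k.1),
    sum_restrictModes h (fun k => (1 / eigenvalue L k.1) • modeFun L k.1 ^ 2)]
  rfl

/-- The kernel of a difference of Wick powers is small when both cutoffs are large. -/
theorem exists_kernelSum_le {L : ℝ} (hL : 0 < L) (hL' : L < 2 * Real.pi) (n : ℕ) (hn : n ≤ 3) :
    ∃ A : ℝ, 0 < A ∧ ∀ M N : ℕ,
      kernelSum (fun k : modes N => 1 / eigenvalue L k.1) (fun k => modePair L M k.1)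
        (cellIntegralDiff L) (n + 1) 1 ≤ A * ((M : ℝ) + 1) ^ (-(1 / 8) : ℝ) := by
  classical
  obtain ⟨A, hA, h⟩ := exists_lattice_sum_le hL hL' n hn
  refine ⟨L ^ 4 / L ^ (2 * (n + 1)) * (2 ^ (n + 1) * A), by positivity, fun M N => ?_⟩
  have hs (v : Fin (n + 1) → modes N) : 0 ≤ ∏ j, 1 / eigenvalue L (v j).1 :=
    Finset.prod_nonneg fun j _ =>
      (one_div_pos.2 (eigenvalue_pos hL hL' (ne_zero_of_mem_modes (v j).2))).le
  have hint (v : Fin (n + 1) → modes N) :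
      cellIntegralDiff L (1 * ∏ j, modePair L M (v j).1) ^ 2
        ≤ L ^ 4 / L ^ (2 * (n + 1)) * ∑ σ : Fin (n + 1) → Bool,
          if (∃ j, (v j).1 ∉ modes M) ∧ ∑ j, signOf (σ j) • (v j).1 = 0 then 1 else 0 := by
    have h1 : cellIntegral L (∏ j, modeFun L (v j).1)
        = ∫ x in cell L, ∏ j, realMode L (v j).1 x := by
      simp only [cellIntegral, LinearMap.coe_mk, AddHom.coe_mk, ContinuousMap.coe_prod,
        Finset.prod_apply]
      rfl
    rw [one_mul, cellIntegralDiff, LinearMap.sub_apply, LinearMap.comp_apply,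
      LinearMap.comp_apply, LinearMap.fst_apply, LinearMap.snd_apply, Prod.fst_prod,
      Prod.snd_prod]
    simp only [modePair]
    by_cases hM : ∃ j, (v j).1 ∉ modes M
    · obtain ⟨j, hj⟩ := hM
      have h0 : ∏ j, (if (v j).1 ∈ modes M then modeFun L (v j).1 else 0) = 0 :=
        Finset.prod_eq_zero (Finset.mem_univ j) (if_neg hj)
      have hM : ∃ j, (v j).1 ∉ modes M := ⟨j, hj⟩
      rw [h0, map_zero, sub_zero, h1]
      simp only [hM, true_and]
      exact sq_integral_prod_realMode_le hL fun j => (v j).1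
    · push Not at hM
      simp only [hM, if_true, sub_self]
      rw [sq, zero_mul]
      exact mul_nonneg (by positivity)
        (Finset.sum_nonneg fun σ _ => by split_ifs <;> norm_num)
  rw [kernelSum_eq]
  calc _ ≤ ∑ v : Fin (n + 1) → modes N, (∏ j, 1 / eigenvalue L (v j).1)
        * (L ^ 4 / L ^ (2 * (n + 1)) * ∑ σ : Fin (n + 1) → Bool,
          if (∃ j, (v j).1 ∉ modes M) ∧ ∑ j, signOf (σ j) • (v j).1 = 0 then 1 else 0) :=
        Finset.sum_le_sum fun v _ => mul_le_mul_of_nonneg_left (hint v) (hs v)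
    _ = L ^ 4 / L ^ (2 * (n + 1)) * ∑ σ : Fin (n + 1) → Bool, ∑ v : Fin (n + 1) → modes N,
          (∏ j, 1 / eigenvalue L (v j).1) *
          if (∃ j, (v j).1 ∉ modes M) ∧ ∑ j, signOf (σ j) • (v j).1 = 0 then 1 else 0 := by
        rw [Finset.sum_comm, Finset.mul_sum]
        refine Finset.sum_congr rfl fun v _ => ?_
        rw [mul_left_comm, Finset.mul_sum]
    _ ≤ L ^ 4 / L ^ (2 * (n + 1)) * ∑ _σ : Fin (n + 1) → Bool,
          A * ((M : ℝ) + 1) ^ (-(1 / 8) : ℝ) := by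
        refine mul_le_mul_of_nonneg_left (Finset.sum_le_sum fun σ _ => ?_) (by positivity)
        exact h M N (fun j => signOf (σ j)) fun j => signOf_ne_zero _
    _ = _ := by
        rw [Finset.sum_const, Finset.card_univ, Fintype.card_fun, Fintype.card_bool,
          Fintype.card_fin, nsmul_eq_mul]
        push_cast
        ring

/-- Moments of the difference of two Wick powers: powers of the moment order are compensated by a
negative power of the lower cutoff. -/
theorem exists_integral_wickIntegral_sub_pow_le {L : ℝ} (hL : 0 < L) (hL' : L < 2 * Real.pi)
    (n : ℕ) (hn : n ≤ 3) :
    ∃ A : ℝ, 0 < A ∧ ∀ (M N : ℕ) (h : M ≤ N) (m : ℕ),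
      Integrable (fun u : modes N → ℝ => (wickIntegral L (n + 1) u
        - wickIntegral L (n + 1) (restrictModes h u)) ^ (2 * (m + 1))) (gaussianPerp L N) ∧
      ∫ u : modes N → ℝ, (wickIntegral L (n + 1) u
        - wickIntegral L (n + 1) (restrictModes h u)) ^ (2 * (m + 1)) ∂(gaussianPerp L N)
        ≤ (A * (2 * m + 1) ^ 4 * ((M : ℝ) + 1) ^ (-(1 / 8) : ℝ)) ^ (m + 1) := by
  obtain ⟨A, hA, h⟩ := exists_kernelSum_le hL hL' n hn
  refine ⟨(n + 1).factorial * A + 1, by positivity, fun M N hMN m => ?_⟩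
  have := isProbabilityMeasure_gaussianPerp hL hL' N
  have hst := isSteinMeasure_gaussianPerp hL hL' N
  simp only [wickIntegral_sub_restrict]
  refine ⟨by simpa only [map_pow] using hst.integrable (_ ^ (2 * (m + 1))), ?_⟩
  refine hst.integral_wickPoly_pow_le
    (fun k => (one_div_pos.2 (eigenvalue_pos hL hL' (ne_zero_of_mem_modes k.2))).le) _ _ _ _ _ ?_
  have hm : (1 : ℝ) ≤ 2 * m + 1 := by
    have : (0 : ℝ) ≤ m := m.cast_nonneg
    linarith
  have hp : (2 * (m : ℝ) + 1) ^ (n + 1) ≤ (2 * (m : ℝ) + 1) ^ 4 :=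
    pow_le_pow_right₀ hm (by omega)
  have hr : 0 < ((M : ℝ) + 1) ^ (-(1 / 8) : ℝ) := by positivity
  calc _ ≤ (n + 1).factorial * (2 * (m : ℝ) + 1) ^ 4 * (A * ((M : ℝ) + 1) ^ (-(1 / 8) : ℝ)) :=
        mul_le_mul (mul_le_mul_of_nonneg_left hp (by positivity)) (h M N)
          (kernelSum_nonneg _ _ _ (fun k => (one_div_pos.2
            (eigenvalue_pos hL hL' (ne_zero_of_mem_modes k.2))).le) _ _) (by positivity)
    _ = (n + 1).factorial * A * (2 * (m : ℝ) + 1) ^ 4 * ((M : ℝ) + 1) ^ (-(1 / 8) : ℝ) := by ring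
    _ < _ := by
        have : 0 < (2 * (m : ℝ) + 1) ^ 4 * ((M : ℝ) + 1) ^ (-(1 / 8) : ℝ) := by positivity
        linarith

/-! ### Lower bound of the interaction -/

theorem continuous_field (L : ℝ) {N : ℕ} (u : modes N → ℝ) : Continuous (field L u) := by
  have : field L u = fun x => ∑ k, u k * realMode L k.1 x := funext fun x => field_eq L u x
  rw [this]
  exact continuous_finsetSum _ fun k _ => (continuous_realMode L k.1).const_mul _

/-- Completing squares in the renormalised quartic potential. The cubic term is controlled by the
quadratic and quartic ones because `(3/2) z² + z ψ + ψ²/4` is positive definite. -/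
theorem quartic_ge (z e C τ φ : ℝ) (hC : 0 ≤ C) (hτ : 0 ≤ τ) :
    -(3 / 2 * z ^ 2 * C + 63 / 2 * e ^ 2 * C ^ 2 + 45 / 2 * e ^ 2 * τ ^ 2)
      ≤ 3 / 2 * (z ^ 2 - e ^ 2 * τ) * (φ ^ 2 - C) + z * e * (φ ^ 3 - 3 * C * φ)
        + 1 / 4 * e ^ 2 * (φ ^ 4 - 6 * C * φ ^ 2 + 3 * C ^ 2) := by
  have h1 : 0 ≤ 5 / 4 * (φ * (z + 2 / 5 * e * φ)) ^ 2 := by positivity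
  have h2 : 0 ≤ (z * φ / 2 - 3 * e * C) ^ 2 := sq_nonneg _
  have h3 : 0 ≤ 1 / 40 * (e * (φ ^ 2 - 30 * C)) ^ 2 := by positivity
  have h4 : 0 ≤ 1 / 40 * (e * (φ ^ 2 - 30 * τ)) ^ 2 := by positivity
  have h5 : 0 ≤ 3 / 2 * e ^ 2 * τ * C + 3 / 4 * e ^ 2 * C ^ 2 := by positivity
  linarith

theorem interaction_eq_integral (L ε z₀ : ℝ) {N : ℕ} (u : modes N → ℝ) :
    interaction L ε z₀ u = ∫ x in cell L,
      (3 * (z₀ ^ 2 - ε) / (2 * L ^ 2) * (field L u x ^ 2 - renormConst L N)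
        + z₀ / L * Real.sqrt ε * (field L u x ^ 3 - 3 * renormConst L N * field L u x)
        + 1 / 4 * ε * (field L u x ^ 4 - 6 * renormConst L N * field L u x ^ 2
          + 3 * renormConst L N ^ 2)) := by
  have hc := continuous_field L u
  rw [interaction]
  simp only [wickIntegral]
  rw [← integral_const_mul, ← integral_const_mul, ← integral_const_mul, ← integral_add,
    ← integral_add]
  · refine integral_congr_ae (.of_forall fun x => ?_)
    simp only [eval_hermitePoly, hermiteElem]
    push_cast
    ring
  · exact ((integrableOn_cell L ((hermitePoly _ 2).continuous.comp hc)).const_mul _).add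
      ((integrableOn_cell L ((hermitePoly _ 3).continuous.comp hc)).const_mul _)
  · exact (integrableOn_cell L ((hermitePoly _ 4).continuous.comp hc)).const_mul _
  · exact (integrableOn_cell L ((hermitePoly _ 2).continuous.comp hc)).const_mul _
  · exact (integrableOn_cell L ((hermitePoly _ 3).continuous.comp hc)).const_mul _

theorem volume_real_cell {L : ℝ} (hL : 0 < L) : volume.real (cell L) = L ^ 2 := by
  rw [cell, Measure.real, Measure.volume_eq_prod, Measure.prod_prod, Real.volume_Ioc, sub_zero,
    ENNReal.toReal_mul, ENNReal.toReal_ofReal hL.le, sq]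

theorem interaction_ge {L : ℝ} (hL : 0 < L) (hL' : L < 2 * Real.pi) {ε : ℝ} (hε : 0 ≤ ε) (z₀ : ℝ)
    {N : ℕ} (u : modes N → ℝ) :
    -(3 / 2 * z₀ ^ 2 * renormConst L N + 63 / 2 * ε * L ^ 2 * renormConst L N ^ 2
      + 45 / 2 * ε / L ^ 2) ≤ interaction L ε z₀ u := by
  have hc := continuous_field L u
  have hC := renormConst_nonneg hL hL' N
  set C := renormConst L N with hCdef
  rw [interaction_eq_integral]
  have hconst : ∫ _x in cell L, -(3 / 2 * (z₀ / L) ^ 2 * C + 63 / 2 * Real.sqrt ε ^ 2 * C ^ 2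
      + 45 / 2 * Real.sqrt ε ^ 2 * (1 / L ^ 2) ^ 2)
      = -(3 / 2 * z₀ ^ 2 * C + 63 / 2 * ε * L ^ 2 * C ^ 2 + 45 / 2 * ε / L ^ 2) := by
    rw [setIntegral_const, volume_real_cell hL, smul_eq_mul, Real.sq_sqrt hε]
    field_simp
  rw [← hconst]
  refine integral_mono (integrableOn_cell L continuous_const) (integrableOn_cell L (by fun_prop))
    fun x => ?_
  refine (quartic_ge (z₀ / L) (Real.sqrt ε) C (1 / L ^ 2) (field L u x) hC (by positivity)).trans
    (le_of_eq ?_)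
  rw [Real.sq_sqrt hε, ← hCdef]
  field_simp

/-- The lower bound in terms of the dyadic scale `j` of the cutoff. -/
theorem exists_interaction_ge {L : ℝ} (hL : 0 < L) (hL' : L < 2 * Real.pi) :
    ∃ c : ℝ, 0 < c ∧ ∀ (N j : ℕ), N ≤ 2 ^ j → ∀ ε : ℝ, 0 ≤ ε → ε ≤ 1 → ∀ R z₀ : ℝ, z₀ ^ 2 ≤ R →
      ∀ u : modes N → ℝ,
        -(c * (R * (j + 1) + ((j : ℝ) + 1) ^ 2)) ≤ interaction L ε z₀ u := by
  obtain ⟨K, hK, hKN⟩ := exists_renormConst_le hL hL'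
  refine ⟨3 / 2 * K + 63 / 2 * L ^ 2 * K ^ 2 + 45 / 2 / L ^ 2, by positivity,
    fun N j hj ε hε hε1 R z₀ hz u => le_trans ?_ (interaction_ge hL hL' hε z₀ u)⟩
  have hC0 := renormConst_nonneg hL hL' N
  have hC := hKN N j hj
  set C := renormConst L N
  have hR : 0 ≤ R := (sq_nonneg z₀).trans hz
  have hj0 : (0 : ℝ) ≤ j := j.cast_nonneg
  have h1 : z₀ ^ 2 * C ≤ R * (K * (j + 1)) := mul_le_mul hz hC hC0 hR
  have h2 : ε * C ^ 2 ≤ 1 * (K * (j + 1)) ^ 2 :=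
    mul_le_mul hε1 (pow_le_pow_left₀ hC0 hC 2) (by positivity) zero_le_one
  have h2' := mul_le_mul_of_nonneg_left h2 (show 0 ≤ 63 / 2 * L ^ 2 by positivity)
  have h3 : 45 / 2 * ε / L ^ 2 ≤ 45 / 2 / L ^ 2 * ((j : ℝ) + 1) ^ 2 := by
    have h4 : ε ≤ ((j : ℝ) + 1) ^ 2 := by nlinarith
    calc 45 / 2 * ε / L ^ 2 = 45 / 2 / L ^ 2 * ε := by ring
      _ ≤ _ := by gcongr
  have h5 : 0 ≤ 3 / 2 * K * ((j : ℝ) + 1) ^ 2 := by positivity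
  have h6 : 0 ≤ (63 / 2 * L ^ 2 * K ^ 2 + 45 / 2 / L ^ 2) * (R * ((j : ℝ) + 1)) := by positivity
  linarith

/-! ### Exponential moments by Nelson's argument -/

theorem wickIntegral_modes_zero (L : ℝ) (n : ℕ) (u : modes 0 → ℝ) :
    wickIntegral L (n + 1) u = 0 := by
  have h : IsEmpty (modes 0) := ⟨fun k => by
    have h := mem_modes_iff.1 k.2
    have := one_le_supNorm h.1
    omega⟩
  have hH : hermiteElem (0 : ℝ) 0 (n + 1) = 0 := by
    cases n <;> simp [hermiteElem]
  have hr : renormConst L 0 = 0 := by simp [renormConst]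
  have hf (x) : field L u x = 0 := by simp [field]
  simp only [wickIntegral, eval_hermitePoly, hr, hf, hH, integral_zero]

theorem continuous_wickIntegral (L : ℝ) {N : ℕ} (n : ℕ) :
    Continuous (fun u : modes N → ℝ => wickIntegral L (n + 1) u) := by
  have h (u : modes N → ℝ) := wickIntegral_sub_restrict L (Nat.zero_le N) (n + 1) u
  simp only [wickIntegral_modes_zero, sub_zero] at h
  simp only [h]
  exact MvPolynomial.continuous_eval _

theorem continuous_interaction (L ε z₀ : ℝ) (N : ℕ) :
    Continuous (fun u : modes N → ℝ => interaction L ε z₀ u) :=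
  (((continuous_wickIntegral L 1).const_mul _).add
    ((continuous_wickIntegral L 2).const_mul _)).add ((continuous_wickIntegral L 3).const_mul _)

theorem integrable_exp_neg_interaction {L : ℝ} (hL : 0 < L) (hL' : L < 2 * Real.pi) {ε : ℝ}
    (hε : 0 ≤ ε) (z₀ : ℝ) (N : ℕ) {p : ℝ} (hp : 0 ≤ p) :
    Integrable (fun u : modes N → ℝ => Real.exp (-(p * interaction L ε z₀ u)))
      (gaussianPerp L N) := by
  have := isProbabilityMeasure_gaussianPerp hL hL' N
  refine Integrable.of_bound
    (((continuous_interaction L ε z₀ N).const_mul p).neg.rexp.aestronglyMeasurable)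
    (Real.exp (p * (3 / 2 * z₀ ^ 2 * renormConst L N + 63 / 2 * ε * L ^ 2 * renormConst L N ^ 2
      + 45 / 2 * ε / L ^ 2))) (.of_forall fun u => ?_)
  rw [Real.norm_of_nonneg (Real.exp_pos _).le, Real.exp_le_exp, ← mul_neg]
  exact mul_le_mul_of_nonneg_left (neg_le.1 (interaction_ge hL hL' hε z₀ u)) hp

theorem add_add_pow_le {a b c : ℝ} (ha : 0 ≤ a) (hb : 0 ≤ b) (hc : 0 ≤ c) (k : ℕ) :
    (a + b + c) ^ k ≤ 3 ^ k * (a ^ k + b ^ k + c ^ k) := by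
  have key (M : ℝ) (h1 : a + b + c ≤ 3 * M) (h2 : M ^ k ≤ a ^ k + b ^ k + c ^ k) :
      (a + b + c) ^ k ≤ 3 ^ k * (a ^ k + b ^ k + c ^ k) :=
    (pow_le_pow_left₀ (by positivity) h1 k).trans (by rw [mul_pow]; gcongr)
  have ha' := pow_nonneg ha k
  have hb' := pow_nonneg hb k
  have hc' := pow_nonneg hc k
  rcases le_total a b with hab | hab <;> rcases le_total b c with hbc | hbc <;>
    rcases le_total a c with hac | hac
  all_goals first
    | exact key a (by linarith) (by linarith)
    | exact key b (by linarith) (by linarith)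
    | exact key c (by linarith) (by linarith)

/-- Moments of a linear combination of differences of Wick powers. -/
theorem exists_integral_comb_pow_le {L : ℝ} (hL : 0 < L) (hL' : L < 2 * Real.pi) :
    ∃ A : ℝ, 0 < A ∧ ∀ (M N : ℕ) (h : M ≤ N) (m : ℕ) (Q c₂ c₃ c₄ : ℝ), c₂ ^ 2 ≤ Q → c₃ ^ 2 ≤ Q →
      c₄ ^ 2 ≤ Q →
      Integrable (fun u : modes N → ℝ =>
        (c₂ * (wickIntegral L 2 u - wickIntegral L 2 (restrictModes h u))
          + c₃ * (wickIntegral L 3 u - wickIntegral L 3 (restrictModes h u))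
          + c₄ * (wickIntegral L 4 u - wickIntegral L 4 (restrictModes h u))) ^ (2 * (m + 1)))
        (gaussianPerp L N) ∧
      ∫ u : modes N → ℝ,
        (c₂ * (wickIntegral L 2 u - wickIntegral L 2 (restrictModes h u))
          + c₃ * (wickIntegral L 3 u - wickIntegral L 3 (restrictModes h u))
          + c₄ * (wickIntegral L 4 u - wickIntegral L 4 (restrictModes h u))) ^ (2 * (m + 1))
        ∂(gaussianPerp L N)
        ≤ (A * Q * (2 * m + 1) ^ 4 * ((M : ℝ) + 1) ^ (-(1 / 8) : ℝ)) ^ (m + 1) := by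
  obtain ⟨A₂, hA₂, h₂⟩ := exists_integral_wickIntegral_sub_pow_le hL hL' 1 (by norm_num)
  obtain ⟨A₃, hA₃, h₃⟩ := exists_integral_wickIntegral_sub_pow_le hL hL' 2 (by norm_num)
  obtain ⟨A₄, hA₄, h₄⟩ := exists_integral_wickIntegral_sub_pow_le hL hL' 3 (by norm_num)
  refine ⟨27 * (A₂ + A₃ + A₄), by positivity, fun M N h m Q c₂ c₃ c₄ hc₂ hc₃ hc₄ => ?_⟩
  obtain ⟨i₂, h₂⟩ := h₂ M N h m
  obtain ⟨i₃, h₃⟩ := h₃ M N h m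
  obtain ⟨i₄, h₄⟩ := h₄ M N h m
  have hQ : 0 ≤ Q := (sq_nonneg _).trans hc₂
  set x := fun u : modes N → ℝ => wickIntegral L 2 u - wickIntegral L 2 (restrictModes h u)
  set y := fun u : modes N → ℝ => wickIntegral L 3 u - wickIntegral L 3 (restrictModes h u)
  set z := fun u : modes N → ℝ => wickIntegral L 4 u - wickIntegral L 4 (restrictModes h u)
  set t := (2 * (m : ℝ) + 1) ^ 4 * ((M : ℝ) + 1) ^ (-(1 / 8) : ℝ) with ht
  have ht0 : 0 ≤ t := by positivity
  have hpt (u : modes N → ℝ) : (c₂ * x u + c₃ * y u + c₄ * z u) ^ (2 * (m + 1))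
      ≤ (9 * Q) ^ (m + 1) * (x u ^ (2 * (m + 1)) + y u ^ (2 * (m + 1)) + z u ^ (2 * (m + 1))) := by
    have hsq : (c₂ * x u + c₃ * y u + c₄ * z u) ^ 2 ≤ 3 * Q * (x u ^ 2 + y u ^ 2 + z u ^ 2) := by
      have h1 := mul_le_mul_of_nonneg_right hc₂ (sq_nonneg (x u))
      have h2 := mul_le_mul_of_nonneg_right hc₃ (sq_nonneg (y u))
      have h3 := mul_le_mul_of_nonneg_right hc₄ (sq_nonneg (z u))
      nlinarith [sq_nonneg (c₂ * x u - c₃ * y u), sq_nonneg (c₂ * x u - c₄ * z u),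
        sq_nonneg (c₃ * y u - c₄ * z u)]
    have h1 := add_add_pow_le (sq_nonneg (x u)) (sq_nonneg (y u)) (sq_nonneg (z u)) (m + 1)
    simp only [pow_mul]
    calc ((c₂ * x u + c₃ * y u + c₄ * z u) ^ 2) ^ (m + 1)
        ≤ (3 * Q * (x u ^ 2 + y u ^ 2 + z u ^ 2)) ^ (m + 1) :=
          pow_le_pow_left₀ (sq_nonneg _) hsq _
      _ = (3 * Q) ^ (m + 1) * (x u ^ 2 + y u ^ 2 + z u ^ 2) ^ (m + 1) := mul_pow _ _ _
      _ ≤ (3 * Q) ^ (m + 1) * (3 ^ (m + 1)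
            * ((x u ^ 2) ^ (m + 1) + (y u ^ 2) ^ (m + 1) + (z u ^ 2) ^ (m + 1))) := by gcongr
      _ = _ := by
        rw [← mul_assoc, ← mul_pow]
        ring_nf
  replace i₂ : Integrable (fun u => x u ^ (2 * (m + 1))) (gaussianPerp L N) := i₂
  replace i₃ : Integrable (fun u => y u ^ (2 * (m + 1))) (gaussianPerp L N) := i₃
  replace i₄ : Integrable (fun u => z u ^ (2 * (m + 1))) (gaussianPerp L N) := i₄
  have i₂₃ : Integrable (fun u => x u ^ (2 * (m + 1)) + y u ^ (2 * (m + 1))) (gaussianPerp L N) :=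
    i₂.add i₃
  have hint : Integrable (fun u => (9 * Q) ^ (m + 1)
      * (x u ^ (2 * (m + 1)) + y u ^ (2 * (m + 1)) + z u ^ (2 * (m + 1)))) (gaussianPerp L N) :=
    (i₂₃.add i₄).const_mul _
  have hmeas : AEStronglyMeasurable (fun u : modes N → ℝ =>
      (c₂ * x u + c₃ * y u + c₄ * z u) ^ (2 * (m + 1))) (gaussianPerp L N) := by
    have hres : Continuous (fun u : modes N → ℝ => restrictModes h u) :=
      continuous_pi fun k => continuous_apply _
    have hx : Continuous x := (continuous_wickIntegral L 1).sub
      ((continuous_wickIntegral L 1).comp hres)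
    have hy : Continuous y := (continuous_wickIntegral L 2).sub
      ((continuous_wickIntegral L 2).comp hres)
    have hz : Continuous z := (continuous_wickIntegral L 3).sub
      ((continuous_wickIntegral L 3).comp hres)
    exact Continuous.aestronglyMeasurable (by fun_prop)
  have hi : Integrable (fun u : modes N → ℝ =>
      (c₂ * x u + c₃ * y u + c₄ * z u) ^ (2 * (m + 1))) (gaussianPerp L N) := by
    refine hint.mono' hmeas (.of_forall fun u => ?_)
    rw [Real.norm_of_nonneg (by rw [pow_mul]; positivity)]
    exact hpt u
  refine ⟨hi, (integral_mono hi hint hpt).trans ?_⟩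
  rw [integral_const_mul, integral_add i₂₃ i₄, integral_add i₂ i₃]
  have hle (A : ℝ) (hA : 0 < A) (hA' : A ≤ A₂ + A₃ + A₄) :
      (A * (2 * m + 1) ^ 4 * ((M : ℝ) + 1) ^ (-(1 / 8) : ℝ)) ^ (m + 1)
        ≤ ((A₂ + A₃ + A₄) * t) ^ (m + 1) := by
    rw [mul_assoc, ← ht]
    gcongr
  have k₂ := h₂.trans (hle A₂ hA₂ (by linarith))
  have k₃ := h₃.trans (hle A₃ hA₃ (by linarith))
  have k₄ := h₄.trans (hle A₄ hA₄ (by linarith))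
  have h3 : (3 : ℝ) ≤ 3 ^ (m + 1) := by
    calc (3 : ℝ) = 3 ^ 1 := (pow_one _).symm
      _ ≤ 3 ^ (m + 1) := pow_le_pow_right₀ (by norm_num) (by omega)
  calc _ ≤ (9 * Q) ^ (m + 1) * (3 * ((A₂ + A₃ + A₄) * t) ^ (m + 1)) := by
        refine mul_le_mul_of_nonneg_left ?_ (by positivity)
        linarith
    _ ≤ (9 * Q) ^ (m + 1) * (3 ^ (m + 1) * ((A₂ + A₃ + A₄) * t) ^ (m + 1)) := by gcongr
    _ = _ := by
        rw [← mul_pow, ← mul_pow, ht]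
        congr 1
        ring

theorem interaction_sub (L ε z₀ : ℝ) {M N : ℕ} (u : modes N → ℝ) (v : modes M → ℝ) :
    interaction L ε z₀ u - interaction L ε z₀ v
      = 3 * (z₀ ^ 2 - ε) / (2 * L ^ 2) * (wickIntegral L 2 u - wickIntegral L 2 v)
        + z₀ / L * Real.sqrt ε * (wickIntegral L 3 u - wickIntegral L 3 v)
        + 1 / 4 * ε * (wickIntegral L 4 u - wickIntegral L 4 v) := by
  simp only [interaction]
  ring

theorem exists_integral_interaction_sub_pow_le {L : ℝ} (hL : 0 < L) (hL' : L < 2 * Real.pi) :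
    ∃ A : ℝ, 0 < A ∧ ∀ (M N : ℕ) (h : M ≤ N) (m : ℕ) (ε : ℝ), 0 ≤ ε → ε ≤ 1 →
      ∀ R z₀ : ℝ, 1 ≤ R → z₀ ^ 2 ≤ R →
      Integrable (fun u : modes N → ℝ =>
        (interaction L ε z₀ u - interaction L ε z₀ (restrictModes h u)) ^ (2 * (m + 1)))
        (gaussianPerp L N) ∧
      ∫ u : modes N → ℝ,
        (interaction L ε z₀ u - interaction L ε z₀ (restrictModes h u)) ^ (2 * (m + 1))
        ∂(gaussianPerp L N)
        ≤ (A * R ^ 2 * (2 * m + 1) ^ 4 * ((M : ℝ) + 1) ^ (-(1 / 8) : ℝ)) ^ (m + 1) := by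
  obtain ⟨A, hA, h⟩ := exists_integral_comb_pow_le hL hL'
  set q : ℝ := (3 / (2 * L ^ 2)) ^ 2 + 1 / L ^ 2 + 1 with hq
  have hq1 : 0 < (3 / (2 * L ^ 2)) ^ 2 := by positivity
  have hq2 : 0 < 1 / L ^ 2 := by positivity
  refine ⟨A * q, by positivity, fun M N hMN m ε hε hε1 R z₀ hR hz => ?_⟩
  simp only [interaction_sub]
  have hR2 : 0 < R ^ 2 := by positivity
  have hRR : R ≤ R ^ 2 := by nlinarith
  have h2 : (3 * (z₀ ^ 2 - ε) / (2 * L ^ 2)) ^ 2 ≤ q * R ^ 2 := by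
    have h1 : (z₀ ^ 2 - ε) ^ 2 ≤ R ^ 2 := sq_le_sq' (by nlinarith) (by linarith)
    calc (3 * (z₀ ^ 2 - ε) / (2 * L ^ 2)) ^ 2
        = (3 / (2 * L ^ 2)) ^ 2 * (z₀ ^ 2 - ε) ^ 2 := by ring
      _ ≤ (3 / (2 * L ^ 2)) ^ 2 * R ^ 2 := by gcongr
      _ ≤ q * R ^ 2 := by
        refine mul_le_mul_of_nonneg_right ?_ hR2.le
        linarith
  have h3 : (z₀ / L * Real.sqrt ε) ^ 2 ≤ q * R ^ 2 := by
    calc (z₀ / L * Real.sqrt ε) ^ 2 = 1 / L ^ 2 * (z₀ ^ 2 * ε) := by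
          rw [mul_pow, div_pow, Real.sq_sqrt hε]
          ring
      _ ≤ 1 / L ^ 2 * (R ^ 2 * 1) := by
          refine mul_le_mul_of_nonneg_left ?_ hq2.le
          exact mul_le_mul (hz.trans hRR) hε1 hε hR2.le
      _ ≤ q * R ^ 2 := by
        rw [mul_one]
        refine mul_le_mul_of_nonneg_right ?_ hR2.le
        linarith
  have h4 : (1 / 4 * ε) ^ 2 ≤ q * R ^ 2 := by
    have h5 : (1 / 4 * ε) ^ 2 ≤ 1 := by nlinarith
    have h6 : 1 ≤ R ^ 2 := by nlinarith
    have h7 : 1 * R ^ 2 ≤ q * R ^ 2 := mul_le_mul_of_nonneg_right (by linarith) hR2.le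
    linarith
  have := h M N hMN m (q * R ^ 2) _ _ _ h2 h3 h4
  refine ⟨this.1, this.2.trans (le_of_eq ?_)⟩
  congr 1
  ring

/-- Tail bounds along a sequence of levels give an exponential moment. -/
theorem integral_exp_le_of_tail {Ω : Type*} [MeasurableSpace Ω] {μ : Measure Ω}
    [IsProbabilityMeasure μ] {w : Ω → ℝ} (hw : Measurable w) {b : ℕ → ℝ} {J K : ℕ} (hJK : J ≤ K)
    (hK : ∀ ω, -(2 * b K) ≤ w ω)
    (hp : ∀ j, J ≤ j → μ.real {ω | w ω < -(2 * b j)} ≤ Real.exp (-(4 * b (j + 1) + j))) :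
    ∫ ω, Real.exp (-(2 * w ω)) ∂μ ≤ Real.exp (4 * b J) + 2 := by
  set S : ℕ → Set Ω := fun j => {ω | w ω < -(2 * b j)} with hS
  have hSm (j) : MeasurableSet (S j) := measurableSet_lt hw measurable_const
  set g : ℕ → Ω → ℝ := fun j => (S j).indicator fun _ => Real.exp (4 * b (j + 1)) with hg
  have hg0 (j ω) : 0 ≤ g j ω := Set.indicator_nonneg (fun _ _ => (Real.exp_pos _).le) ω
  have hpt (ω : Ω) (n : ℕ) (hn : J ≤ n) : -(2 * b n) ≤ w ω →
      Real.exp (-(2 * w ω)) ≤ Real.exp (4 * b J) + ∑ j ∈ Finset.Ico J n, g j ω := by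
    induction n, hn using Nat.le_induction with
    | base =>
      intro h
      simp only [Finset.Ico_self, Finset.sum_empty, add_zero]
      exact Real.exp_le_exp.2 (by linarith)
    | succ n hn ih =>
      intro h
      rw [Finset.sum_Ico_succ_top hn]
      by_cases h' : -(2 * b n) ≤ w ω
      · linarith [ih h', hg0 n ω]
      · have hgn : g n ω = Real.exp (4 * b (n + 1)) :=
          Set.indicator_of_mem (show ω ∈ S n from not_le.1 h') _
        have h1 : Real.exp (-(2 * w ω)) ≤ g n ω := by
          rw [hgn]
          exact Real.exp_le_exp.2 (by linarith)
        have h2 : 0 ≤ ∑ j ∈ Finset.Ico J n, g j ω := Finset.sum_nonneg fun j _ => hg0 j ω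
        linarith [Real.exp_pos (4 * b J)]
  have hgi (j) : Integrable (g j) μ := (integrable_const _).indicator (hSm j)
  have hsum : Integrable (fun ω => ∑ j ∈ Finset.Ico J K, g j ω) μ :=
    integrable_finsetSum _ fun j _ => hgi j
  have h1 : ∫ ω, Real.exp (-(2 * w ω)) ∂μ
      ≤ ∫ ω, (Real.exp (4 * b J) + ∑ j ∈ Finset.Ico J K, g j ω) ∂μ := by
    refine integral_mono_of_nonneg (.of_forall fun ω => (Real.exp_pos _).le)
      ((integrable_const _).add hsum) (.of_forall fun ω => hpt ω K hJK (hK ω))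
  refine h1.trans ?_
  rw [integral_add (integrable_const _) hsum, integral_const, probReal_univ, one_smul,
    integral_finsetSum _ fun j _ => hgi j]
  have h2 (j) (hj : j ∈ Finset.Ico J K) : ∫ ω, g j ω ∂μ ≤ (1 / 2) ^ j := by
    rw [hg, integral_indicator_const _ (hSm j), smul_eq_mul]
    calc μ.real (S j) * Real.exp (4 * b (j + 1))
        ≤ Real.exp (-(4 * b (j + 1) + j)) * Real.exp (4 * b (j + 1)) :=
          mul_le_mul_of_nonneg_right (hp j (Finset.mem_Ico.1 hj).1) (Real.exp_pos _).le
      _ = Real.exp (-1) ^ j := by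
          rw [← Real.exp_add, ← Real.exp_nat_mul]
          congr 1
          ring
      _ ≤ (1 / 2) ^ j := by
          refine pow_le_pow_left₀ (Real.exp_pos _).le ?_ j
          rw [Real.exp_neg, ← one_div]
          exact one_div_le_one_div_of_le two_pos (by linarith [Real.add_one_le_exp 1])
  have h3 : ∑ j ∈ Finset.Ico J K, ∫ ω, g j ω ∂μ ≤ 2 := by
    refine (Finset.sum_le_sum h2).trans ?_
    refine (Finset.sum_le_sum_of_subset_of_nonneg (t := Finset.range K) (fun j hj => ?_)
      fun j _ _ => by positivity).trans (sum_geometric_two_le K)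
    exact Finset.mem_range.2 (Finset.mem_Ico.1 hj).2
  linarith

/-- Beyond a scale logarithmic in `R`, powers of `R` and of the scale are dominated. -/
theorem exists_scale (a : ℝ) :
    ∃ j₁ : ℕ, ∀ R : ℝ, 1 ≤ R → ∀ j : ℕ, j₁ + ⌈100 * Real.log R⌉₊ ≤ j →
      a * R ^ 4 * ((j : ℝ) + 2) ^ 8 * ((2 : ℝ) ^ j) ^ (-(1 / 8) : ℝ) ≤ Real.exp (-1) := by
  set r : ℝ := (2 : ℝ) ^ (1 / 16 : ℝ) with hr
  have hr1 : 1 < r := Real.one_lt_rpow one_lt_two (by norm_num)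
  have hr0 : 0 < r := zero_lt_one.trans hr1
  have ht := ((tendsto_pow_const_div_const_pow_of_one_lt 8 hr1).comp
    (Filter.tendsto_add_atTop_nat 2)).const_mul (|a| * r ^ 2)
  rw [mul_zero] at ht
  obtain ⟨j₁, hj₁⟩ := Filter.eventually_atTop.1 (ht.eventually_le_const (Real.exp_pos (-1)))
  refine ⟨j₁, fun R hR j hj => ?_⟩
  have h1 := hj₁ j (by omega)
  have hrj : 0 < r ^ j := pow_pos hr0 j
  have hR0 : 0 < R := zero_lt_one.trans_le hR
  have hRr : R ^ 4 ≤ r ^ j := by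
    have hlog : 100 * Real.log R ≤ j :=
      (Nat.le_ceil _).trans (by exact_mod_cast (Nat.le_add_left _ _).trans hj)
    have hlogR := Real.log_nonneg hR
    rw [← Real.log_le_log_iff (by positivity) hrj, Real.log_pow, Real.log_pow, hr,
      Real.log_rpow two_pos]
    push_cast
    nlinarith [Real.log_two_gt_d9, mul_nonneg (sub_nonneg.2 hlog) (Real.log_pos one_lt_two).le]
  have h2 : ((2 : ℝ) ^ j) ^ (-(1 / 8) : ℝ) = (r ^ j * r ^ j)⁻¹ := by
    rw [Real.rpow_neg (by positivity), ← mul_pow, hr, ← Real.rpow_add two_pos,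
      ← Real.rpow_natCast, ← Real.rpow_natCast, ← Real.rpow_mul two_pos.le,
      ← Real.rpow_mul two_pos.le]
    congr 2
    ring
  have h3 : |a| * ((j : ℝ) + 2) ^ 8 / r ^ j ≤ Real.exp (-1) := by
    refine le_trans (le_of_eq ?_) h1
    simp only [Function.comp_apply]
    push_cast
    rw [pow_add]
    field_simp
  calc a * R ^ 4 * ((j : ℝ) + 2) ^ 8 * ((2 : ℝ) ^ j) ^ (-(1 / 8) : ℝ)
      ≤ |a| * r ^ j * ((j : ℝ) + 2) ^ 8 * ((2 : ℝ) ^ j) ^ (-(1 / 8) : ℝ) := by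
        gcongr
        exact le_abs_self a
    _ = |a| * ((j : ℝ) + 2) ^ 8 / r ^ j := by
        rw [h2]
        field_simp
    _ ≤ _ := h3

/-- Nelson's estimate, uniform in the cutoff `N`. -/
theorem exists_integral_exp_interaction_le {L : ℝ} (hL : 0 < L) (hL' : L < 2 * Real.pi) :
    ∃ C : ℝ, 0 < C ∧ ∀ (N : ℕ) (ε : ℝ), 0 ≤ ε → ε ≤ 1 → ∀ R z₀ : ℝ, 1 ≤ R → z₀ ^ 2 ≤ R →
      ∫ u : modes N → ℝ, Real.exp (-(2 * interaction L ε z₀ u)) ∂(gaussianPerp L N)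
        ≤ Real.exp (C * (R * Real.log (1 + R))) := by
  obtain ⟨c, hc, hlow⟩ := exists_interaction_ge hL hL'
  obtain ⟨A, hA, hmom⟩ := exists_integral_interaction_sub_pow_le hL hL'
  obtain ⟨j₁, hj₁⟩ := exists_scale (A / c ^ 2 * (16 * c + 3) ^ 4)
  set E : ℝ := 2 * (j₁ + 2) + 100 with hE
  have hE0 : 0 < E := by positivity
  refine ⟨4 * c * (E + E ^ 2) + 4, by positivity, fun N ε hε hε1 R z₀ hR hz => ?_⟩
  have := isProbabilityMeasure_gaussianPerp hL hL' N
  have hR0 : 0 < R := zero_lt_one.trans_le hR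
  set J := j₁ + ⌈100 * Real.log R⌉₊ with hJ
  set b : ℕ → ℝ := fun j => c * (R * (j + 1) + ((j : ℝ) + 1) ^ 2) with hb
  have hb0 (j) : c * R ≤ b j := by
    have hj : (0 : ℝ) ≤ j := j.cast_nonneg
    simp only [hb]
    refine mul_le_mul_of_nonneg_left ?_ hc.le
    nlinarith
  have hcR : 0 < c * R := mul_pos hc hR0
  have htail (j : ℕ) (hj : J ≤ j) :
      (gaussianPerp L N).real {u | interaction L ε z₀ u < -(2 * b j)}
        ≤ Real.exp (-(4 * b (j + 1) + j)) := by
    have hbj := hb0 j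
    rcases le_total N (2 ^ j) with hN | hN
    · -- the cutoff is below the scale, so that the event is empty
      have hempty : {u : modes N → ℝ | interaction L ε z₀ u < -(2 * b j)} = ∅ := by
        refine Set.eq_empty_of_forall_notMem fun u hu => ?_
        have h1 := hlow N j hN ε hε hε1 R z₀ hz u
        have h2 : interaction L ε z₀ u < -(2 * b j) := hu
        simp only [hb] at hbj h2
        linarith
      rw [hempty, measureReal_empty]
      exact (Real.exp_pos _).le
    · have hj0 : (0 : ℝ) ≤ j := j.cast_nonneg
      set m := ⌈4 * b (j + 1) + j⌉₊ with hm
      obtain ⟨hi, hle⟩ := hmom (2 ^ j) N hN m ε hε hε1 R z₀ hR hz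
      set D := fun u : modes N → ℝ =>
        (interaction L ε z₀ u - interaction L ε z₀ (restrictModes hN u)) ^ (2 * (m + 1)) with hD
      have hD0 (u) : 0 ≤ D u := by
        simp only [hD, pow_mul]
        positivity
      have hmarkov := mul_meas_ge_le_integral_of_nonneg (.of_forall hD0) hi
        ((c * R) ^ (2 * (m + 1)))
      have hsub : {u : modes N → ℝ | interaction L ε z₀ u < -(2 * b j)}
          ⊆ {u | (c * R) ^ (2 * (m + 1)) ≤ D u} := fun u hu => by
        have h1 := hlow (2 ^ j) j le_rfl ε hε hε1 R z₀ hz (restrictModes hN u)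
        have h2 : interaction L ε z₀ u < -(2 * b j) := hu
        have h3 : c * R ≤ interaction L ε z₀ (restrictModes hN u) - interaction L ε z₀ u := by
          simp only [hb] at hbj h2
          linarith
        simp only [hD, Set.mem_ofPred_eq, pow_mul]
        refine pow_le_pow_left₀ (sq_nonneg _) ?_ _
        rw [← neg_sub, neg_sq]
        exact pow_le_pow_left₀ hcR.le h3 2
      have hprob : (gaussianPerp L N).real {u | interaction L ε z₀ u < -(2 * b j)}
          ≤ (A / c ^ 2 * (2 * m + 1) ^ 4 * ((2 : ℝ) ^ j) ^ (-(1 / 8) : ℝ)) ^ (m + 1) := by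
        have hpos : 0 < (c * R) ^ (2 * (m + 1)) := by positivity
        have h1 : (gaussianPerp L N).real {u | interaction L ε z₀ u < -(2 * b j)}
            ≤ (A * R ^ 2 * (2 * m + 1) ^ 4 * (((2 ^ j : ℕ) : ℝ) + 1) ^ (-(1 / 8) : ℝ)) ^ (m + 1)
              / (c * R) ^ (2 * (m + 1)) := by
          rw [le_div_iff₀ hpos, mul_comm]
          exact (mul_le_mul_of_nonneg_left (measureReal_mono hsub) hpos.le).trans
            (hmarkov.trans hle)
        refine h1.trans ?_
        rw [pow_mul (c * R), ← div_pow]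
        refine pow_le_pow_left₀ (by positivity) ?_ _
        rw [div_le_iff₀ (by positivity)]
        have h2 : (((2 ^ j : ℕ) : ℝ) + 1) ^ (-(1 / 8) : ℝ) ≤ ((2 : ℝ) ^ j) ^ (-(1 / 8) : ℝ) := by
          push_cast
          exact Real.rpow_le_rpow_of_nonpos (by positivity) (by linarith) (by norm_num)
        calc A * R ^ 2 * (2 * m + 1) ^ 4 * (((2 ^ j : ℕ) : ℝ) + 1) ^ (-(1 / 8) : ℝ)
            ≤ A * R ^ 2 * (2 * m + 1) ^ 4 * ((2 : ℝ) ^ j) ^ (-(1 / 8) : ℝ) := by gcongr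
          _ = _ := by field_simp
      have hm1 : 4 * b (j + 1) + j ≤ m := Nat.le_ceil _
      have hm2 : 2 * (m : ℝ) + 1 ≤ (16 * c + 3) * (R * ((j : ℝ) + 2) ^ 2) := by
        have hbn : 0 ≤ 4 * b (j + 1) + j := by linarith [hb0 (j + 1)]
        have h1 : (m : ℝ) < 4 * b (j + 1) + j + 1 := Nat.ceil_lt_add_one hbn
        have h2 : b (j + 1) ≤ 2 * c * (R * ((j : ℝ) + 2) ^ 2) := by
          simp only [hb]
          push_cast
          have h3 : R * ((j : ℝ) + 1 + 1) ≤ R * ((j : ℝ) + 2) ^ 2 :=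
            mul_le_mul_of_nonneg_left (by nlinarith) hR0.le
          have h4 : ((j : ℝ) + 1 + 1) ^ 2 ≤ R * ((j : ℝ) + 2) ^ 2 := by nlinarith
          calc c * (R * ((j : ℝ) + 1 + 1) + ((j : ℝ) + 1 + 1) ^ 2)
              ≤ c * (R * ((j : ℝ) + 2) ^ 2 + R * ((j : ℝ) + 2) ^ 2) := by gcongr
            _ = _ := by ring
        have h5 : 2 * (j : ℝ) + 3 ≤ 3 * (R * ((j : ℝ) + 2) ^ 2) := by nlinarith
        linarith
      have hbase : A / c ^ 2 * (2 * m + 1) ^ 4 * ((2 : ℝ) ^ j) ^ (-(1 / 8) : ℝ)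
          ≤ Real.exp (-1) := by
        refine le_trans ?_ (hj₁ R hR j hj)
        calc A / c ^ 2 * (2 * m + 1) ^ 4 * ((2 : ℝ) ^ j) ^ (-(1 / 8) : ℝ)
            ≤ A / c ^ 2 * ((16 * c + 3) * (R * ((j : ℝ) + 2) ^ 2)) ^ 4
              * ((2 : ℝ) ^ j) ^ (-(1 / 8) : ℝ) := by gcongr
          _ = _ := by ring
      refine hprob.trans ((pow_le_pow_left₀ (by positivity) hbase _).trans ?_)
      rw [← Real.exp_nat_mul, Real.exp_le_exp]
      push_cast
      linarith
  have hK (u : modes N → ℝ) : -(2 * b (max J N)) ≤ interaction L ε z₀ u := by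
    have h1 := hlow N (max J N)
      (Nat.lt_two_pow_self.le.trans (Nat.pow_le_pow_right two_pos (le_max_right _ _)))
      ε hε hε1 R z₀ hz u
    have h2 := hb0 (max J N)
    simp only [hb] at h2 ⊢
    linarith
  refine (integral_exp_le_of_tail (continuous_interaction L ε z₀ N).measurable
    (le_max_left J N) hK htail).trans ?_
  -- the remaining bound is elementary
  set l := Real.log (1 + R) with hl
  have hl1 : 1 / 2 ≤ l := by
    have := Real.log_le_log two_pos (show (2 : ℝ) ≤ 1 + R by linarith)
    linarith [Real.log_two_gt_d9]
  have hlR : l ≤ R := by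
    have := Real.log_le_sub_one_of_pos (show 0 < 1 + R by linarith)
    linarith
  have hJE : (J : ℝ) + 1 ≤ E * l := by
    have h1 : (⌈100 * Real.log R⌉₊ : ℝ) < 100 * Real.log R + 1 :=
      Nat.ceil_lt_add_one (mul_nonneg (by norm_num) (Real.log_nonneg hR))
    have h2 : Real.log R ≤ l := Real.log_le_log hR0 (by linarith)
    have h3 : (j₁ : ℝ) + 2 ≤ 2 * (j₁ + 2) * l := by
      have : (0 : ℝ) ≤ j₁ := j₁.cast_nonneg
      nlinarith
    rw [hJ, hE]
    push_cast
    linarith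
  have hbJ : b J ≤ c * (E + E ^ 2) * (R * l) := by
    have h1 : R * ((J : ℝ) + 1) ≤ E * (R * l) := by nlinarith
    have h2 : ((J : ℝ) + 1) ^ 2 ≤ E ^ 2 * (R * l) := by
      calc ((J : ℝ) + 1) ^ 2 ≤ (E * l) ^ 2 := pow_le_pow_left₀ (by positivity) hJE 2
        _ = E ^ 2 * (l * l) := by ring
        _ ≤ E ^ 2 * (R * l) := by gcongr
    calc b J ≤ c * (E * (R * l) + E ^ 2 * (R * l)) := by
          simp only [hb]
          gcongr
      _ = _ := by ring
  have hRl : 1 / 2 ≤ R * l := by nlinarith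
  have hbJ0 : 0 ≤ b J := hcR.le.trans (hb0 J)
  calc Real.exp (4 * b J) + 2 ≤ Real.exp (4 * b J) * Real.exp 2 := by
        have h1 : 1 ≤ Real.exp (4 * b J) := Real.one_le_exp (by linarith)
        have h2 : (3 : ℝ) ≤ Real.exp 2 := by linarith [Real.add_one_le_exp 2]
        nlinarith
    _ = Real.exp (4 * b J + 2) := (Real.exp_add _ _).symm
    _ ≤ _ := Real.exp_le_exp.2 (by linarith)

/-! ### The quadratic part and the determinant factor -/

theorem integral_cos_sin_phase {L : ℝ} (hL : 0 < L) (k : ℤ × ℤ) :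
    ∫ x in cell L, Real.cos (phase L k x) = (if k = 0 then L ^ 2 else 0) ∧
      ∫ x in cell L, Real.sin (phase L k x) = 0 := by
  have hcont := continuous_phase L k
  have h := integral_exp_phase hL k
  have hsplit (x : ℝ × ℝ) : Complex.exp ((phase L k x : ℂ) * Complex.I)
      = (Real.cos (phase L k x) : ℂ) + (Real.sin (phase L k x) : ℂ) * Complex.I := by
    rw [Complex.exp_mul_I, Complex.ofReal_cos, Complex.ofReal_sin]
  simp only [hsplit] at h
  have hc : IntegrableOn (fun x => (Real.cos (phase L k x) : ℂ)) (cell L) :=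
    integrableOn_cell L (Complex.continuous_ofReal.comp (Real.continuous_cos.comp hcont))
  have hs : IntegrableOn (fun x => (Real.sin (phase L k x) : ℂ) * Complex.I) (cell L) :=
    integrableOn_cell L ((Complex.continuous_ofReal.comp
      (Real.continuous_sin.comp hcont)).mul continuous_const)
  rw [integral_add hc hs, integral_mul_const, integral_complex_ofReal,
    integral_complex_ofReal] at h
  have hre := congrArg Complex.re h
  have him := congrArg Complex.im h
  split_ifs at h hre him ⊢ <;>
    simp [-Complex.ofReal_cos, -Complex.ofReal_sin, ← Complex.ofReal_pow] at hre him <;>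
    exact ⟨hre, him⟩

theorem integral_realMode_mul {L : ℝ} (hL : 0 < L) {k l : ℤ × ℤ} (hl : l ≠ 0) :
    ∫ x in cell L, realMode L k x * realMode L l x = if k = l then 1 else 0 := by
  have hadd (x) : phase L (k + l) x = phase L k x + phase L l x := by
    simp only [phase, Prod.fst_add, Prod.snd_add]
    push_cast
    ring
  have hsub (x) : phase L (k - l) x = phase L k x - phase L l x := by
    simp only [phase, Prod.fst_sub, Prod.snd_sub]
    push_cast
    ring
  have hs : Real.sqrt 2 ^ 2 = 2 := Real.sq_sqrt (by norm_num)
  have hL0 : L ≠ 0 := hL.ne'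
  have ic (q : ℤ × ℤ) : IntegrableOn (fun x => Real.cos (phase L q x)) (cell L) :=
    integrableOn_cell L (Real.continuous_cos.comp (continuous_phase L q))
  have is (q : ℤ × ℤ) : IntegrableOn (fun x => Real.sin (phase L q x)) (cell L) :=
    integrableOn_cell L (Real.continuous_sin.comp (continuous_phase L q))
  have hnl := isUpper_neg_iff hl
  have hsum : (IsUpper k ↔ IsUpper l) → k + l ≠ 0 := fun h h0 => by
    rw [eq_neg_of_add_eq_zero_left h0] at h
    tauto
  by_cases hu : IsUpper k <;> by_cases hv : IsUpper l
  · have e (x) : realMode L k x * realMode L l x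
        = 1 / L ^ 2 * (Real.cos (phase L (k - l) x) + Real.cos (phase L (k + l) x)) := by
      rw [realMode, realMode, if_pos hu, if_pos hv, hadd, hsub, Real.cos_sub, Real.cos_add]
      linear_combination (Real.cos (phase L k x) * Real.cos (phase L l x) / L ^ 2) * hs
    simp only [e]
    rw [integral_const_mul, integral_add (ic _) (ic _), (integral_cos_sin_phase hL _).1,
      (integral_cos_sin_phase hL _).1, if_neg (hsum (iff_of_true hu hv))]
    simp only [sub_eq_zero]
    split_ifs <;> field_simp <;> simp
  · have e (x) : realMode L k x * realMode L l x
        = 1 / L ^ 2 * (Real.sin (phase L (k + l) x) - Real.sin (phase L (k - l) x)) := by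
      rw [realMode, realMode, if_pos hu, if_neg hv, hadd, hsub, Real.sin_sub, Real.sin_add]
      linear_combination (Real.cos (phase L k x) * Real.sin (phase L l x) / L ^ 2) * hs
    simp only [e]
    rw [integral_const_mul, integral_sub (is _) (is _), (integral_cos_sin_phase hL _).2,
      (integral_cos_sin_phase hL _).2, if_neg (show ¬ k = l from fun h => hv (h ▸ hu))]
    simp
  · have e (x) : realMode L k x * realMode L l x
        = 1 / L ^ 2 * (Real.sin (phase L (k + l) x) + Real.sin (phase L (k - l) x)) := by
      rw [realMode, realMode, if_neg hu, if_pos hv, hadd, hsub, Real.sin_sub, Real.sin_add]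
      linear_combination (Real.sin (phase L k x) * Real.cos (phase L l x) / L ^ 2) * hs
    simp only [e]
    rw [integral_const_mul, integral_add (is _) (is _), (integral_cos_sin_phase hL _).2,
      (integral_cos_sin_phase hL _).2, if_neg (show ¬ k = l from fun h => hu (h ▸ hv))]
    simp
  · have e (x) : realMode L k x * realMode L l x
        = 1 / L ^ 2 * (Real.cos (phase L (k - l) x) - Real.cos (phase L (k + l) x)) := by
      rw [realMode, realMode, if_neg hu, if_neg hv, hadd, hsub, Real.cos_sub, Real.cos_add]
      linear_combination (Real.sin (phase L k x) * Real.sin (phase L l x) / L ^ 2) * hs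
    simp only [e]
    rw [integral_const_mul, integral_sub (ic _) (ic _), (integral_cos_sin_phase hL _).1,
      (integral_cos_sin_phase hL _).1, if_neg (hsum (iff_of_false hu hv))]
    simp only [sub_eq_zero]
    split_ifs <;> field_simp <;> simp

/-- Parseval's identity for the fluctuating field. -/
theorem integral_field_sq {L : ℝ} (hL : 0 < L) {N : ℕ} (u : modes N → ℝ) :
    ∫ x in cell L, field L u x ^ 2 = ∑ k, u k ^ 2 := by
  classical
  have h (x) : field L u x ^ 2
      = ∑ k, ∑ l, u k * u l * (realMode L k.1 x * realMode L l.1 x) := by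
    rw [field_eq, sq, Finset.sum_mul_sum]
    exact Finset.sum_congr rfl fun k _ => Finset.sum_congr rfl fun l _ => by ring
  have hi (k l : modes N) :
      IntegrableOn (fun x => u k * u l * (realMode L k.1 x * realMode L l.1 x)) (cell L) :=
    integrableOn_cell L
      (((continuous_realMode L k.1).mul (continuous_realMode L l.1)).const_mul _)
  simp only [h]
  rw [integral_finsetSum _ fun k _ => integrable_finsetSum _ fun l _ => hi k l]
  refine Finset.sum_congr rfl fun k _ => ?_
  rw [integral_finsetSum _ fun l _ => hi k l]
  simp only [integral_const_mul, integral_realMode_mul hL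
    (ne_zero_of_mem_modes (Subtype.prop _)), ← Subtype.ext_iff]
  simp [sq]

theorem wickIntegral_two {L : ℝ} (hL : 0 < L) {N : ℕ} (u : modes N → ℝ) :
    wickIntegral L 2 u = ∑ k : modes N, (u k ^ 2 - 1 / eigenvalue L k.1) := by
  have hc := continuous_field L u
  have h : wickIntegral L 2 u = ∫ x in cell L, (field L u x ^ 2 - renormConst L N) := by
    refine integral_congr_ae (.of_forall fun x => ?_)
    simp only [eval_hermitePoly, hermiteElem]
    push_cast
    ring
  rw [h, integral_sub (integrableOn_cell L (by fun_prop)) (integrableOn_cell L continuous_const),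
    integral_field_sq hL, setIntegral_const, volume_real_cell hL, smul_eq_mul, renormConst,
    Finset.sum_sub_distrib]
  field_simp

theorem integral_exp_quadratic_gaussDensity {l a : ℝ} (hl : 0 < l) (ha : 0 ≤ a) :
    ∫ x, Real.exp (-(a * (x ^ 2 - 1 / l))) * gaussDensity l x
      = Real.sqrt (Real.exp (2 * a / l) / (1 + 2 * a / l)) := by
  have h (x : ℝ) : Real.exp (-(a * (x ^ 2 - 1 / l))) * gaussDensity l x
      = Real.exp (a / l) / Real.sqrt (2 * Real.pi / l) * Real.exp (-(a + l / 2) * x ^ 2) := by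
    rw [gaussDensity, mul_div_assoc', ← Real.exp_add, div_mul_eq_mul_div, ← Real.exp_add]
    congr 2
    ring
  simp only [h]
  have hpos : 0 < a + l / 2 := by positivity
  rw [integral_const_mul, integral_gaussian, div_mul_eq_mul_div, mul_div_assoc,
    ← Real.sqrt_div (by positivity), Real.sqrt_div (Real.exp_pos _).le, Real.sqrt_eq_rpow
    (Real.exp _), ← Real.exp_mul, div_eq_mul_inv (Real.exp _), ← Real.sqrt_inv]
  congr 2
  · ring
  · field_simp
    ring

/-- The exponential moment of the quadratic part is exactly the determinant factor. -/
theorem integral_exp_interaction_zero {L : ℝ} (hL : 0 < L) (hL' : L < 2 * Real.pi) (N : ℕ)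
    (z₀ : ℝ) :
    ∫ u : modes N → ℝ, Real.exp (-interaction L 0 z₀ u) ∂(gaussianPerp L N)
      = detFactor L N z₀ := by
  have hl (k : modes N) := eigenvalue_pos hL hL' (ne_zero_of_mem_modes k.2)
  set a := 3 * z₀ ^ 2 / (2 * L ^ 2) with ha
  have ha0 : 0 ≤ a := by positivity
  have h (u : modes N → ℝ) : Real.exp (-interaction L 0 z₀ u)
      = ∏ k : modes N, Real.exp (-(a * (u k ^ 2 - 1 / eigenvalue L k.1))) := by
    rw [interaction, wickIntegral_two hL, ← Real.exp_sum, Finset.sum_neg_distrib,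
      ← Finset.mul_sum, ha]
    simp
  simp only [h]
  rw [integral_gaussianPerp_prod (f := fun k x =>
    Real.exp (-(a * (x ^ 2 - 1 / eigenvalue L k.1)))), detFactor, Real.sqrt_prod]
  · refine Finset.prod_congr rfl fun k _ => ?_
    rw [integral_exp_quadratic_gaussDensity (hl k) ha0]
    have : 2 * a / eigenvalue L k.1 = 3 * z₀ ^ 2 / (L ^ 2 * eigenvalue L k.1) := by
      rw [ha]
      have := (hl k).ne'
      field_simp
    rw [this]
  · intro k _
    have := hl k
    positivity

theorem one_le_detFactor {L : ℝ} (hL : 0 < L) (hL' : L < 2 * Real.pi) (N : ℕ) (z₀ : ℝ) :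
    1 ≤ detFactor L N z₀ := by
  rw [detFactor, Real.one_le_sqrt]
  refine Finset.prod_induction _ (fun x : ℝ => 1 ≤ x)
    (fun _ _ => one_le_mul_of_one_le_of_one_le) le_rfl fun k _ => ?_
  have := eigenvalue_pos hL hL' (ne_zero_of_mem_modes k.2)
  have h0 : 0 ≤ 3 * z₀ ^ 2 / (L ^ 2 * eigenvalue L k.1) := by positivity
  rw [one_le_div (by positivity)]
  linarith [Real.add_one_le_exp (3 * z₀ ^ 2 / (L ^ 2 * eigenvalue L k.1))]

/-! ### Perturbation of the quadratic part -/

/-- The non-quadratic part of the interaction has second moment of order `ε` for `|z₀| ≤ 1`. -/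
theorem exists_integral_interaction_sub_sq_le {L : ℝ} (hL : 0 < L) (hL' : L < 2 * Real.pi) :
    ∃ A : ℝ, 0 < A ∧ ∀ (N : ℕ) (ε : ℝ), 0 ≤ ε → ε ≤ 1 → ∀ z₀ : ℝ, z₀ ^ 2 ≤ 1 →
      Integrable (fun u : modes N → ℝ => (interaction L ε z₀ u - interaction L 0 z₀ u) ^ 2)
        (gaussianPerp L N) ∧
      ∫ u : modes N → ℝ, (interaction L ε z₀ u - interaction L 0 z₀ u) ^ 2 ∂(gaussianPerp L N)
        ≤ A * ε := by
  obtain ⟨A, hA, h⟩ := exists_integral_comb_pow_le hL hL'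
  set q : ℝ := (3 / (2 * L ^ 2)) ^ 2 + 1 / L ^ 2 + 1 with hq
  have hq1 : 0 < (3 / (2 * L ^ 2)) ^ 2 := by positivity
  have hq2 : 0 < 1 / L ^ 2 := by positivity
  refine ⟨A * q, by positivity, fun N ε hε hε1 z₀ hz => ?_⟩
  have hεε : ε ^ 2 ≤ ε := by nlinarith
  have h2 : (-(3 * ε / (2 * L ^ 2))) ^ 2 ≤ q * ε := by
    calc (-(3 * ε / (2 * L ^ 2))) ^ 2 = (3 / (2 * L ^ 2)) ^ 2 * ε ^ 2 := by ring
      _ ≤ (3 / (2 * L ^ 2)) ^ 2 * ε := mul_le_mul_of_nonneg_left hεε hq1.le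
      _ ≤ q * ε := mul_le_mul_of_nonneg_right (by linarith) hε
  have h3 : (z₀ / L * Real.sqrt ε) ^ 2 ≤ q * ε := by
    calc (z₀ / L * Real.sqrt ε) ^ 2 = 1 / L ^ 2 * (z₀ ^ 2 * ε) := by
          rw [mul_pow, div_pow, Real.sq_sqrt hε]
          ring
      _ ≤ 1 / L ^ 2 * (1 * ε) :=
          mul_le_mul_of_nonneg_left (mul_le_mul_of_nonneg_right hz hε) hq2.le
      _ ≤ q * ε := by
          rw [one_mul]
          exact mul_le_mul_of_nonneg_right (by linarith) hε
  have h4 : (1 / 4 * ε) ^ 2 ≤ q * ε := by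
    have : ε ≤ q * ε := le_mul_of_one_le_left hε (by linarith)
    nlinarith
  have h5 := h 0 N (Nat.zero_le N) 0 (q * ε) _ _ _ h2 h3 h4
  have he (u : modes N → ℝ) : interaction L ε z₀ u - interaction L 0 z₀ u
      = -(3 * ε / (2 * L ^ 2))
          * (wickIntegral L 2 u - wickIntegral L 2 (restrictModes (Nat.zero_le N) u))
        + z₀ / L * Real.sqrt ε
          * (wickIntegral L 3 u - wickIntegral L 3 (restrictModes (Nat.zero_le N) u))
        + 1 / 4 * ε
          * (wickIntegral L 4 u - wickIntegral L 4 (restrictModes (Nat.zero_le N) u)) := by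
    rw [wickIntegral_modes_zero L 1, wickIntegral_modes_zero L 2, wickIntegral_modes_zero L 3,
      interaction, interaction, Real.sqrt_zero]
    ring
  simp only [he]
  refine ⟨h5.1, h5.2.trans (le_of_eq ?_)⟩
  simp
  ring

theorem exp_neg_le_one_add (x : ℝ) : Real.exp (-x) ≤ 1 + |x| * (1 + Real.exp (-x)) := by
  rcases le_total 0 x with h | h
  · have h1 : Real.exp (-x) ≤ 1 := Real.exp_le_one_iff.2 (by linarith)
    have h2 : 0 ≤ |x| * (1 + Real.exp (-x)) := by positivity
    linarith
  · rw [abs_of_nonpos h]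
    have h1 : (1 + x) * Real.exp (-x) ≤ 1 := by
      calc (1 + x) * Real.exp (-x) ≤ Real.exp x * Real.exp (-x) :=
            mul_le_mul_of_nonneg_right (by linarith [Real.add_one_le_exp x]) (Real.exp_pos _).le
        _ = 1 := by rw [← Real.exp_add, add_neg_cancel, Real.exp_zero]
    linarith

theorem mul_exp_neg_le {r : ℝ} (hr : 0 < r) (x y : ℝ) :
    |x| * Real.exp (-y) ≤ 1 / (2 * r) * x ^ 2 + r / 2 * Real.exp (-(2 * y)) := by
  have h : Real.exp (-(2 * y)) = Real.exp (-y) ^ 2 := by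
    rw [← Real.exp_nat_mul]
    congr 1
    push_cast
    ring
  have h1 : 1 / (2 * r) * x ^ 2 + r / 2 * Real.exp (-y) ^ 2 - |x| * Real.exp (-y)
      = 1 / (2 * r) * (|x| - r * Real.exp (-y)) ^ 2 := by
    rw [← sq_abs x]
    field_simp
    ring
  have h2 : 0 ≤ 1 / (2 * r) * (|x| - r * Real.exp (-y)) ^ 2 := by positivity
  rw [h]
  linarith

/-- For bounded `z₀` the exponential moment is the determinant factor up to `O(√ε)`. -/
theorem exists_integral_exp_le_of_sq_le_one {L : ℝ} (hL : 0 < L) (hL' : L < 2 * Real.pi) :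
    ∃ B : ℝ, 0 < B ∧ ∀ (N : ℕ) (ε : ℝ), 0 < ε → ε ≤ 1 → ∀ z₀ : ℝ, z₀ ^ 2 ≤ 1 →
      ∫ u : modes N → ℝ, Real.exp (-interaction L ε z₀ u) ∂(gaussianPerp L N)
        ≤ detFactor L N z₀ + B * Real.sqrt ε := by
  obtain ⟨A, hA, hsq⟩ := exists_integral_interaction_sub_sq_le hL hL'
  obtain ⟨C, hC, hexp⟩ := exists_integral_exp_interaction_le hL hL'
  refine ⟨A + Real.exp (C * (1 * Real.log (1 + 1))), by positivity,
    fun N ε hε hε1 z₀ hz => ?_⟩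
  set r := Real.sqrt ε with hr
  have hr0 : 0 < r := Real.sqrt_pos.2 hε
  have hrr : r ^ 2 = ε := Real.sq_sqrt hε.le
  obtain ⟨iX, hX⟩ := hsq N ε hε.le hε1 z₀ hz
  have e0 := hexp N 0 le_rfl zero_le_one 1 z₀ le_rfl hz
  have e1 := hexp N ε hε.le hε1 1 z₀ le_rfl hz
  set G := Real.exp (C * (1 * Real.log (1 + 1)))
  set w := fun u : modes N → ℝ => interaction L ε z₀ u
  set Q := fun u : modes N → ℝ => interaction L 0 z₀ u
  have i0 : Integrable (fun u => Real.exp (-(2 * Q u))) (gaussianPerp L N) :=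
    integrable_exp_neg_interaction hL hL' le_rfl z₀ N zero_le_two
  have i1 : Integrable (fun u => Real.exp (-(2 * w u))) (gaussianPerp L N) :=
    integrable_exp_neg_interaction hL hL' hε.le z₀ N zero_le_two
  have iQ : Integrable (fun u => Real.exp (-Q u)) (gaussianPerp L N) := by
    simpa only [one_mul] using
      integrable_exp_neg_interaction hL hL' le_rfl z₀ N (p := 1) zero_le_one
  have hpt (u : modes N → ℝ) : Real.exp (-w u) ≤ Real.exp (-Q u)
      + (1 / r * (w u - Q u) ^ 2 + (r / 2 * Real.exp (-(2 * Q u))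
        + r / 2 * Real.exp (-(2 * w u)))) := by
    have h1 := mul_le_mul_of_nonneg_left (exp_neg_le_one_add (w u - Q u)) (Real.exp_pos (-Q u)).le
    have h2 : Real.exp (-Q u) * Real.exp (-(w u - Q u)) = Real.exp (-w u) := by
      rw [← Real.exp_add]
      congr 1
      ring
    have h3 := mul_exp_neg_le hr0 (w u - Q u) (Q u)
    have h4 := mul_exp_neg_le hr0 (w u - Q u) (w u)
    have h5 : Real.exp (-Q u) * (1 + |w u - Q u| * (1 + Real.exp (-(w u - Q u))))
        = Real.exp (-Q u) + |w u - Q u| * Real.exp (-Q u) + |w u - Q u| * Real.exp (-w u) := by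
      rw [← h2]
      ring
    have h6 : 1 / r * (w u - Q u) ^ 2
        = 1 / (2 * r) * (w u - Q u) ^ 2 + 1 / (2 * r) * (w u - Q u) ^ 2 := by
      field_simp
      ring
    rw [h2, h5] at h1
    linarith
  have iR2 : Integrable (fun u => r / 2 * Real.exp (-(2 * Q u))
      + r / 2 * Real.exp (-(2 * w u))) (gaussianPerp L N) := (i0.const_mul _).add (i1.const_mul _)
  have iX' : Integrable (fun u => 1 / r * (w u - Q u) ^ 2) (gaussianPerp L N) := iX.const_mul _
  have iR1 : Integrable (fun u => 1 / r * (w u - Q u) ^ 2 + (r / 2 * Real.exp (-(2 * Q u))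
      + r / 2 * Real.exp (-(2 * w u)))) (gaussianPerp L N) := iX'.add iR2
  have h1 := integral_mono_of_nonneg (.of_forall fun u => (Real.exp_pos (-w u)).le)
    (iQ.add iR1) (.of_forall hpt)
  refine h1.trans ?_
  simp only [Pi.add_apply]
  rw [integral_add iQ iR1, integral_add iX' iR2, integral_add (i0.const_mul _) (i1.const_mul _),
    integral_const_mul, integral_const_mul, integral_const_mul,
    integral_exp_interaction_zero hL hL']
  have h2 : 1 / r * ∫ u, (w u - Q u) ^ 2 ∂(gaussianPerp L N) ≤ A * r := by
    calc 1 / r * ∫ u, (w u - Q u) ^ 2 ∂(gaussianPerp L N) ≤ 1 / r * (A * ε) :=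
          mul_le_mul_of_nonneg_left hX (by positivity)
      _ = A * r := by
          rw [← hrr]
          field_simp
  have h3 := mul_le_mul_of_nonneg_left e0 (half_pos hr0).le
  have h4 := mul_le_mul_of_nonneg_left e1 (half_pos hr0).le
  linarith

/-- The exponential factor of the bound absorbs a factor `1/ε`. -/
theorem two_mul_exp_le {C M s ε : ℝ} (hC : 0 ≤ C) (hM : C + 10 ≤ M) (hs : 1 / 2 ≤ s) (hε : 0 < ε)
    (hε1 : ε ≤ 1) : 2 * Real.exp (C * s) ≤ M * ε * Real.exp (M * s / Real.sqrt ε) := by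
  set r := Real.sqrt ε with hr
  have hr0 : 0 < r := Real.sqrt_pos.2 hε
  have hrr : r ^ 2 = ε := Real.sq_sqrt hε.le
  have hr1 : r ≤ 1 := Real.sqrt_le_one.2 hε1
  have hs0 : 0 < s := by linarith
  have h1 : C * s + 5 / r ≤ M * s / r := by
    rw [le_div_iff₀ hr0, add_mul, div_mul_cancel₀ _ hr0.ne']
    have h2 : C * s * r ≤ C * s := mul_le_of_le_one_right (by positivity) hr1
    nlinarith
  have h3 : 25 / (2 * ε) ≤ Real.exp (5 / r) := by
    have h4 := Real.quadratic_le_exp_of_nonneg (show 0 ≤ 5 / r by positivity)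
    have h5 : (5 / r) ^ 2 / 2 = 25 / (2 * ε) := by
      rw [div_pow, hrr]
      field_simp
      norm_num
    have h6 : 0 ≤ 5 / r := by positivity
    linarith
  have hM0 : 10 ≤ M := by linarith
  calc 2 * Real.exp (C * s) ≤ M * (25 / 2) * Real.exp (C * s) :=
        mul_le_mul_of_nonneg_right (by linarith) (Real.exp_pos _).le
    _ = M * ε * (Real.exp (C * s) * (25 / (2 * ε))) := by field_simp
    _ ≤ M * ε * (Real.exp (C * s) * Real.exp (5 / r)) := by gcongr
    _ = M * ε * Real.exp (C * s + 5 / r) := by rw [Real.exp_add]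
    _ ≤ _ := by gcongr

end AllenCahn

end

theorem proposition5p5 (L : ℝ) (hL : 0 < L) (hL' : L < 2 * Real.pi) :
    ∃ M : ℝ, 0 < M ∧ ∃ ε₀ : ℝ, 0 < ε₀ ∧
      ∀ (N : ℕ) (ε : ℝ), 0 < ε → ε < ε₀ → ∀ z₀ : ℝ,
        MeasureTheory.Integrable
            (fun y : AllenCahn.modes N → ℝ => Real.exp (-AllenCahn.interaction L ε z₀ y))
            (AllenCahn.gaussianPerp L N) ∧
          ∫ y : AllenCahn.modes N → ℝ, Real.exp (-AllenCahn.interaction L ε z₀ y)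
              ∂(AllenCahn.gaussianPerp L N)
            ≤ AllenCahn.detFactor L N z₀ *
                (1 + M * Real.sqrt ε * (1 + |z₀|) *
                  (1 + Real.sqrt ε *
                    Real.exp (M * z₀ ^ 2 * Real.log (1 + z₀ ^ 2) / Real.sqrt ε))) := by
  obtain ⟨B, hB, hsmall⟩ := AllenCahn.exists_integral_exp_le_of_sq_le_one hL hL'
  obtain ⟨C, hC, hexp⟩ := AllenCahn.exists_integral_exp_interaction_le hL hL'
  refine ⟨B + C + 10, by positivity, 1, one_pos, fun N ε hε hε1 z₀ => ?_⟩
  have hint : MeasureTheory.Integrable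
      (fun y : AllenCahn.modes N → ℝ => Real.exp (-AllenCahn.interaction L ε z₀ y))
      (AllenCahn.gaussianPerp L N) := by
    simpa only [one_mul] using
      AllenCahn.integrable_exp_neg_interaction hL hL' hε.le z₀ N (p := 1) zero_le_one
  refine ⟨hint, ?_⟩
  have hK := AllenCahn.one_le_detFactor hL hL' N z₀
  set K := AllenCahn.detFactor L N z₀
  set M := B + C + 10 with hM
  have hM0 : 0 < M := by positivity
  have hr : 0 < Real.sqrt ε := Real.sqrt_pos.2 hε
  have hrr : Real.sqrt ε * Real.sqrt ε = ε := Real.mul_self_sqrt hε.le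
  set X := Real.exp (M * z₀ ^ 2 * Real.log (1 + z₀ ^ 2) / Real.sqrt ε) with hX
  have hX0 : 0 < X := Real.exp_pos _
  rcases le_total (z₀ ^ 2) 1 with hz | hz
  · refine (hsmall N ε hε hε1.le z₀ hz).trans ?_
    have h1 : B * Real.sqrt ε ≤ M * Real.sqrt ε * (1 + |z₀|) * (1 + Real.sqrt ε * X) := by
      calc B * Real.sqrt ε ≤ M * Real.sqrt ε := by
            gcongr
            linarith
        _ ≤ M * Real.sqrt ε * (1 + |z₀|) :=
            le_mul_of_one_le_right (by positivity) (by linarith [abs_nonneg z₀])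
        _ ≤ _ := by
            refine le_mul_of_one_le_right (by positivity) ?_
            have : 0 < Real.sqrt ε * X := by positivity
            linarith
    have h0 : 0 ≤ B * Real.sqrt ε := by positivity
    nlinarith
  · have := AllenCahn.isProbabilityMeasure_gaussianPerp hL hL' N
    set s := z₀ ^ 2 * Real.log (1 + z₀ ^ 2) with hs
    have hlog : 1 / 2 ≤ Real.log (1 + z₀ ^ 2) := by
      have := Real.log_le_log two_pos (show (2 : ℝ) ≤ 1 + z₀ ^ 2 by linarith)
      linarith [Real.log_two_gt_d9]
    have hs1 : 1 / 2 ≤ s := by nlinarith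
    have h2 := hexp N ε hε.le hε1.le (z₀ ^ 2) z₀ hz le_rfl
    have i2 := AllenCahn.integrable_exp_neg_interaction hL hL' hε.le z₀ N (p := 2) zero_le_two
    have h3 : ∫ y : AllenCahn.modes N → ℝ, Real.exp (-AllenCahn.interaction L ε z₀ y)
        ∂(AllenCahn.gaussianPerp L N) ≤ 1 + Real.exp (C * s) := by
      have h4 := MeasureTheory.integral_mono hint
        ((MeasureTheory.integrable_const (1 : ℝ)).add i2) fun y => by
          have h5 : Real.exp (-(2 * AllenCahn.interaction L ε z₀ y))
              = Real.exp (-AllenCahn.interaction L ε z₀ y) ^ 2 := by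
            rw [← Real.exp_nat_mul]
            congr 1
            push_cast
            ring
          simp only [Pi.add_apply, h5]
          nlinarith [sq_nonneg (Real.exp (-AllenCahn.interaction L ε z₀ y) - 1 / 2)]
      simp only [Pi.add_apply] at h4
      rw [MeasureTheory.integral_add (MeasureTheory.integrable_const 1) i2,
        MeasureTheory.integral_const, MeasureTheory.probReal_univ, one_smul] at h4
      linarith
    have h4 : 1 ≤ Real.exp (C * s) := Real.one_le_exp (by positivity)
    have h5 := AllenCahn.two_mul_exp_le hC.le (show C + 10 ≤ M by linarith) hs1 hε hε1.le
    have h6 : Real.exp (M * s / Real.sqrt ε) = X := by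
      rw [hX, hs, ← mul_assoc]
    rw [h6] at h5
    have h7 : M * ε * X ≤ M * Real.sqrt ε * (1 + |z₀|) * (1 + Real.sqrt ε * X) := by
      calc M * ε * X = M * (Real.sqrt ε * Real.sqrt ε) * X := by rw [hrr]
        _ = M * Real.sqrt ε * 1 * (Real.sqrt ε * X) := by ring
        _ ≤ _ := by
            gcongr
            · linarith [abs_nonneg z₀]
            · linarith
    have h8 : 0 ≤ M * ε * X := by positivity
    nlinarith
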